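/- Let $\Lambda=\mathbb{Q}[p_1,p_2,\dots]$ be the ring of symmetric functions over $\mathbb{Q}$, with the scalar product $\langle p_\lambda,p_\mu\rangle=\delta_{\lambda\mu}z_\lambda$, where $z_\lambda=\prod_i i^{n_i(\lambda)}n_i(\lambda)!$ and $n_i(\lambda)$ is the number of parts of $\lambda$ equal to $i$, with the Schur functions $s_\lambda$, and with the involution $\omega$ given by the algebra map $p_k\mapsto(-1)^{k-1}p_k$. For $f\in\Lambda$ let $f^\perp$ be the adjoint of multiplication by $f$. For $m\in\mathbb{Z}$ let $S_m=\sum_{k\ge0}(-1)^k h_{m+k}e_k^\perp$ be the Bernstein operator (with $h_n=0$ for $n<0$) and $\tilde S_m=\omega S_m\omega$. For a linear operator $V$ on $\Lambda$ define its hat $\widehat V$ by $$\widehat V P[X]=\bigl(V^Y P[X-Y]\bigr)\big|_{Y=X},$$ where $P[X-Y]$ is obtained from $P$ by the substitution $p_k\mapsto p_k[X]-p_k[Y]$, where $V^Y$ acts on the $Y$ variables only, and where $Y=X$ is set afterwards. A ribbon is a skew diagram $R=\lambda/\lambda^{rc}$, where $\lambda=(\lambda_1\ge\dots\ge\lambda_\ell>0)$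 is a nonempty partition and $\lambda^{rc}$ is the partition obtained by removing the first row and the first column of $\lambda$. Its size is its number of cells. Diagrams are drawn with the largest row at the bottom. Label the cells of a ribbon $R$ of size $k$ with $1,\dots,k$ from left to right and top to bottom; the descent set of $R$ is $$D(R)=\{i\in\{1,\dots,k-1\}: \text{cell } i+1 \text{ lies below cell } i\}.$$ Put $$S^R=s_{\lambda^{rc}}^\perp\,\tilde S_{\lambda'_1}\tilde S_{\lambda'_2}\cdots\tilde S_{\lambda'_{\lambda_1}},$$ where $\lambda'_i$ is the length of the $i$-th column of $\lambda$. **Theorem 7.** Let $R$ be a ribbon of size $k\ge 1$. There is exactly one ribbon $\bar R$ of size $k$ with $D(\bar R)=\{1,\dots,k-1\}\setminus D(R)$, and $$\omega\,\widehat{S^R}\,\omega\,(s_\nu)=S^{\bar R}(s_\nu)\qquad\text{for all partitions }\nu\text{ with }\ell(\nu)\le k,$$ where $\ell(\nu)$ is the number of nonzero parts of $\nu$. -/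

import Mathlib

open scoped TensorProduct

namespace RibbonOps

noncomputable section

/-- The space of symmetric functions, as polynomials over `ℚ` in the power sums
`p₁, p₂, p₃, …`; the variable with index `k` is `p_k`. A monomial is an exponent vector
`n : ℕ+ →₀ ℕ`, that is, a partition with `n i` parts equal to `i`. -/
abbrev Sym : Type := MvPolynomial ℕ+ ℚ

/-- The power sum `p_k`. -/
def p (k : ℕ+) : Sym := MvPolynomial.X k

/-- The complete homogeneous symmetric functions `h_n`, expressed in power sums through
`h₀ = 1` and `n h_n = ∑_{1 ≤ i ≤ n} p_i h_{n-i}`. -/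
def h : ℕ → Sym
  | 0 => 1
  | n + 1 => (1 / ((n : ℚ) + 1)) •
      ∑ i : Fin (n + 1), p (Nat.succPNat i) * h (n - i)
decreasing_by omega

/-- The elementary symmetric functions `e_n`, expressed in power sums through
`e₀ = 1` and `n e_n = ∑_{1 ≤ i ≤ n} (-1)^{i-1} p_i e_{n-i}`. -/
def e : ℕ → Sym
  | 0 => 1
  | n + 1 => (1 / ((n : ℚ) + 1)) •
      ∑ i : Fin (n + 1), (-1) ^ (i : ℕ) * p (Nat.succPNat i) * e (n - i)
decreasing_by omega

/-- `h_m` for an integer index, with `h_m = 0` for `m < 0`. -/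
def hInt : ℤ → Sym
  | Int.ofNat n => h n
  | Int.negSucc _ => 0

/-- The Schur function `s_μ = det (h_{μ_i - i + j})` of a partition. -/
def schur (μ : YoungDiagram) : Sym :=
  Matrix.det (Matrix.of fun i j : Fin (μ.colLen 0) =>
    hInt ((μ.rowLen i : ℤ) - (i : ℤ) + (j : ℤ)))

/-- The involution `ω`: the algebra map with `p_k ↦ (-1)^{k-1} p_k`. -/
def omega : Sym →ₗ[ℚ] Sym :=
  (MvPolynomial.aeval fun k : ℕ+ => (-1) ^ ((k : ℕ) - 1) * p k : Sym →ₐ[ℚ] Sym).toLinearMap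

/-! ### The scalar product and skewing -/

/-- `z_n = ∏ i^{n_i} n_i!`. -/
def z (n : ℕ+ →₀ ℕ) : ℚ := n.prod fun i a => ((i : ℕ) : ℚ) ^ a * (a.factorial : ℚ)

theorem z_ne_zero (n : ℕ+ →₀ ℕ) : z n ≠ 0 := by
  unfold z
  refine Finset.prod_ne_zero_iff.2 fun i _ => ?_
  have h1 : ((i : ℕ) : ℚ) ≠ 0 := by exact_mod_cast i.ne_zero
  have h2 : ((n i).factorial : ℚ) ≠ 0 := by exact_mod_cast (n i).factorial_ne_zero
  exact mul_ne_zero (pow_ne_zero _ h1) h2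

/-- The scalar product with `⟨p_n, p_m⟩ = δ_{nm} z_n`. -/
def hall : Sym →ₗ[ℚ] Sym →ₗ[ℚ] ℚ :=
  (MvPolynomial.basisMonomials ℕ+ ℚ).constr ℚ fun n =>
    (MvPolynomial.basisMonomials ℕ+ ℚ).constr ℚ fun m => if n = m then z n else 0

/-- `skew f = f^⊥`, the operator dual to multiplication by `f`. On power sums it is given by
`p_n^⊥ p_m = (z_m / z_{m-n}) p_{m-n}` if `n ≤ m`, and `0` otherwise. -/
def skew : Sym →ₗ[ℚ] Sym →ₗ[ℚ] Sym :=
  (MvPolynomial.basisMonomials ℕ+ ℚ).constr ℚ fun n =>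
    (MvPolynomial.basisMonomials ℕ+ ℚ).constr ℚ fun m =>
      if n ≤ m then MvPolynomial.monomial (m - n) (z m / z (m - n)) else 0

theorem hall_monomial (n m : ℕ+ →₀ ℕ) :
    hall (MvPolynomial.monomial n 1) (MvPolynomial.monomial m 1) = if n = m then z n else 0 := by
  have a := (MvPolynomial.basisMonomials ℕ+ ℚ).constr_basis ℚ
    (fun n => (MvPolynomial.basisMonomials ℕ+ ℚ).constr ℚ fun m => if n = m then z n else 0) n
  have b := (MvPolynomial.basisMonomials ℕ+ ℚ).constr_basis ℚ
    (fun m => if n = m then z n else 0) m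
  simp only [MvPolynomial.coe_basisMonomials] at a b
  rw [hall, a, b]

theorem skew_monomial (n m : ℕ+ →₀ ℕ) :
    skew (MvPolynomial.monomial n 1) (MvPolynomial.monomial m 1) =
      if n ≤ m then MvPolynomial.monomial (m - n) (z m / z (m - n)) else 0 := by
  have a := (MvPolynomial.basisMonomials ℕ+ ℚ).constr_basis ℚ
    (fun n => (MvPolynomial.basisMonomials ℕ+ ℚ).constr ℚ fun m =>
      if n ≤ m then MvPolynomial.monomial (m - n) (z m / z (m - n)) else 0) n
  have b := (MvPolynomial.basisMonomials ℕ+ ℚ).constr_basis ℚ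
    (fun m => if n ≤ m then MvPolynomial.monomial (m - n) (z m / z (m - n)) else 0) m
  simp only [MvPolynomial.coe_basisMonomials] at a b
  rw [skew, a, b]

/-- `skew f` is the adjoint of multiplication by `f`. -/
theorem hall_skew (f g k : Sym) : hall (skew f g) k = hall g (f * k) := by
  induction f using MvPolynomial.induction_on' with
  | add f f' hf hf' => simp only [map_add, LinearMap.add_apply, add_mul, hf, hf']
  | monomial n a =>
  induction g using MvPolynomial.induction_on' with
  | add f f' hf hf' => simp only [map_add, LinearMap.add_apply, hf, hf']
  | monomial m b =>
  induction k using MvPolynomial.induction_on' with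
  | add f f' hf hf' => simp only [map_add, mul_add, hf, hf']
  | monomial l c =>
  have key : hall (skew (MvPolynomial.monomial n 1) (MvPolynomial.monomial m 1))
      (MvPolynomial.monomial l 1) =
      hall (MvPolynomial.monomial m 1)
        (MvPolynomial.monomial n 1 * MvPolynomial.monomial l 1) := by
    rw [skew_monomial, MvPolynomial.monomial_mul, one_mul, hall_monomial]
    by_cases hnm : n ≤ m
    · rw [if_pos hnm, ← mul_one (z m / z (m - n)), ← smul_eq_mul, ← MvPolynomial.smul_monomial,
        map_smul, LinearMap.smul_apply, hall_monomial]
      by_cases hl : m - n = l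
      · have : m = n + l := by rw [← hl, add_tsub_cancel_of_le hnm]
        rw [if_pos hl, if_pos this, smul_eq_mul, div_mul_cancel₀ _ (z_ne_zero _)]
      · have : m ≠ n + l := by
          rintro rfl
          exact hl (by simp)
        rw [if_neg hl, if_neg this, smul_zero]
    · have : m ≠ n + l := by
        rintro rfl
        exact hnm le_self_add
      rw [if_neg hnm, if_neg this]
      simp
  have e1 : ∀ (n : ℕ+ →₀ ℕ) (a : ℚ),
      MvPolynomial.monomial n a = a • (MvPolynomial.monomial n 1 : Sym) := by
    intro n a
    rw [MvPolynomial.smul_monomial, smul_eq_mul, mul_one]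
  rw [e1 n a, e1 m b, e1 l c]
  simp only [map_smul, LinearMap.smul_apply, smul_mul_assoc, mul_smul_comm, key]
  simp only [smul_eq_mul]
  ring

/-- The scalar product is nondegenerate, so that adjoints are unique. -/
theorem hall_ext (f g : Sym) (hfg : ∀ k, hall f k = hall g k) : f = g := by
  have key : ∀ (f : Sym) (m : ℕ+ →₀ ℕ),
      hall f (MvPolynomial.monomial m 1) = f.coeff m * z m := by
    intro f m
    induction f using MvPolynomial.induction_on' with
    | add f f' hf hf' =>
      rw [map_add, LinearMap.add_apply, hf, hf', MvPolynomial.coeff_add, add_mul]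
    | monomial n a =>
      have e1 : MvPolynomial.monomial n a = a • (MvPolynomial.monomial n 1 : Sym) := by
        rw [MvPolynomial.smul_monomial, smul_eq_mul, mul_one]
      rw [e1, map_smul, LinearMap.smul_apply, hall_monomial, MvPolynomial.coeff_smul,
        MvPolynomial.coeff_monomial]
      split_ifs with hnm
      · subst hnm; simp
      · simp
  ext m
  have := hfg (MvPolynomial.monomial m 1)
  rw [key, key] at this
  exact mul_right_cancel₀ (z_ne_zero m) this

/-! ### The Bernstein operators -/

/-- `e_n` is homogeneous of degree `n`, where `p_k` has degree `k`. -/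
theorem e_homogeneous (n : ℕ) :
    MvPolynomial.IsWeightedHomogeneous (fun k : ℕ+ => (k : ℕ)) (e n) n := by
  induction n using Nat.strong_induction_on with
  | _ n ih =>
  cases n with
  | zero => rw [e]; exact MvPolynomial.isWeightedHomogeneous_one _ _
  | succ n =>
    rw [e]
    refine (MvPolynomial.weightedHomogeneousSubmodule ℚ _ _).smul_mem _ ?_
    refine Submodule.sum_mem _ fun i _ => ?_
    have h1 := ih (n - i) (by omega)
    have h2 : MvPolynomial.IsWeightedHomogeneous (fun k : ℕ+ => (k : ℕ))
        (p (Nat.succPNat i)) ((i : ℕ) + 1) :=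
      MvPolynomial.isWeightedHomogeneous_X ℚ (fun k : ℕ+ => (k : ℕ)) (Nat.succPNat i)
    have h3 := h2.mul h1
    have h4 : (i : ℕ) + 1 + (n - i) = n + 1 := by omega
    rw [h4] at h3
    have h5 : ((-1) ^ (i : ℕ) * p (Nat.succPNat i) * e (n - i) : Sym) =
        ((-1) ^ (i : ℕ) : ℚ) • (p (Nat.succPNat i) * e (n - i)) := by
      rw [MvPolynomial.smul_eq_C_mul]
      simp [mul_assoc]
    rw [h5]
    exact (MvPolynomial.weightedHomogeneousSubmodule ℚ _ _).smul_mem _ h3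

/-- For a given `f`, only finitely many `e_k^⊥ f` are nonzero. -/
theorem finite_skew_e (f : Sym) : {k : ℕ | skew (e k) f ≠ 0}.Finite := by
  induction f using MvPolynomial.induction_on' with
  | add f g hf hg =>
    refine (hf.union hg).subset fun k hk => ?_
    by_contra hc
    simp only [Set.mem_union, Set.mem_ofPred_eq, not_or, not_not] at hc
    exact hk (by rw [map_add, hc.1, hc.2, add_zero])
  | monomial m a =>
    refine (Set.finite_Iic (Finsupp.weight (fun k : ℕ+ => (k : ℕ)) m)).subset fun k hk => ?_
    by_contra hc
    simp only [Set.mem_Iic, not_le] at hc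
    refine hk ?_
    have e1 : ∀ (n : ℕ+ →₀ ℕ) (a : ℚ),
        MvPolynomial.monomial n a = a • (MvPolynomial.monomial n 1 : Sym) := by
      intro n a
      rw [MvPolynomial.smul_monomial, smul_eq_mul, mul_one]
    rw [e1, map_smul, (e k).as_sum, map_sum, LinearMap.sum_apply]
    refine smul_eq_zero_of_right a (Finset.sum_eq_zero fun n hn => ?_)
    have hw := e_homogeneous k (MvPolynomial.mem_support_iff.1 hn)
    rw [e1, map_smul, LinearMap.smul_apply, skew_monomial, if_neg, smul_zero]
    intro hnm
    have hle : Finsupp.weight (fun k : ℕ+ => (k : ℕ)) n ≤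
        Finsupp.weight (fun k : ℕ+ => (k : ℕ)) m := by
      obtain ⟨c, rfl⟩ := le_iff_exists_add.1 hnm
      rw [map_add]
      exact Nat.le_add_right _ _
    omega

/-- The summand `(-1)^k h_{m+k} e_k^⊥ f` of the Bernstein operator. -/
def bernsteinTerm (m : ℤ) (f : Sym) (k : ℕ) : Sym :=
  (-1) ^ k * hInt (m + k) * skew (e k) f

theorem finite_bernsteinTerm (m : ℤ) (f : Sym) :
    (Function.support (bernsteinTerm m f)).Finite :=
  (finite_skew_e f).subset fun k hk hc => hk (by rw [bernsteinTerm, hc, mul_zero])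

/-- The Bernstein operator `S_m = ∑_{k ≥ 0} (-1)^k h_{m+k} e_k^⊥`; on each `f` the sum is
finite. -/
def S (m : ℤ) : Sym →ₗ[ℚ] Sym where
  toFun f := ∑ᶠ k : ℕ, bernsteinTerm m f k
  map_add' f g := by
    rw [← finsum_add_distrib (finite_bernsteinTerm m f) (finite_bernsteinTerm m g)]
    exact finsum_congr fun k => by simp only [bernsteinTerm, map_add, mul_add]
  map_smul' c f := by
    rw [RingHom.id_apply, smul_finsum' c (finite_bernsteinTerm m f)]
    exact finsum_congr fun k => by simp only [bernsteinTerm, map_smul, mul_smul_comm]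

/-- The column-adding operator `S̃_m = ω S_m ω`. -/
def STilde (m : ℤ) : Sym →ₗ[ℚ] Sym := omega ∘ₗ S m ∘ₗ omega

/-! ### The hat involution -/

/-- The plethystic substitution `P ↦ P[X - Y]`, that is `p_k ↦ p_k[X] - p_k[Y]`. The first
tensor factor holds the symmetric functions in `X`, the second those in `Y`. -/
def substDiff : Sym →ₐ[ℚ] Sym ⊗[ℚ] Sym :=
  MvPolynomial.aeval fun k : ℕ+ => p k ⊗ₜ[ℚ] 1 - 1 ⊗ₜ[ℚ] p k

/-- The hat of an operator: apply `V` to `P[X - Y]` as a function of `Y`, then put `Y = X`. -/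
def hat (V : Sym →ₗ[ℚ] Sym) : Sym →ₗ[ℚ] Sym :=
  LinearMap.mul' ℚ Sym ∘ₗ LinearMap.lTensor Sym V ∘ₗ substDiff.toLinearMap

/-! ### Ribbons -/

/-- `μ^rc`: the partition `μ` with its first row and first column removed. -/
def rc (μ : YoungDiagram) : YoungDiagram where
  cells := μ.cells.filter fun c => (c.1 + 1, c.2 + 1) ∈ μ
  isLowerSet := by
    intro a b hba ha
    simp only [Finset.coe_filter, Set.mem_ofPred_eq, YoungDiagram.mem_cells] at ha ⊢
    exact ⟨μ.isLowerSet hba ha.1,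
      μ.up_left_mem (Nat.succ_le_succ hba.1) (Nat.succ_le_succ hba.2) ha.2⟩

/-- A ribbon, presented as the skew diagram `μ / μ^rc` of a nonempty partition `μ`. -/
@[ext]
structure Ribbon where
  /-- The outer partition `μ`. -/
  outer : YoungDiagram
  /-- A ribbon has at least one cell. -/
  nonempty : outer ≠ ⊥

namespace Ribbon

/-- The cells `(row, column)` of the ribbon. Row `0` is the longest row of the outer partition;
it is drawn at the bottom. -/
def cells (R : Ribbon) : Finset (ℕ × ℕ) := R.outer.cells \ (rc R.outer).cells

/-- The number of cells. -/
def size (R : Ribbon) : ℕ := R.cells.card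

/-- The label in `1, …, k` of a cell, when the `k` cells are labelled from left to right and,
within a column, from top to bottom. -/
def label (R : Ribbon) (x : ℕ × ℕ) : ℕ :=
  (R.cells.filter fun y => y.2 < x.2 ∨ (y.2 = x.2 ∧ x.1 ≤ y.1)).card

/-- The descent set: the `i ∈ [1, k - 1]` such that the cell with label `i + 1` lies below the
cell with label `i`. -/
def descentSet (R : Ribbon) : Finset ℕ :=
  (Finset.Icc 1 (R.size - 1)).filter fun i =>
    ∃ x ∈ R.cells, ∃ y ∈ R.cells, R.label x = i ∧ R.label y = i + 1 ∧ y.1 < x.1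

/-- `R'` is a ribbon of the same size `k` as `R` whose descent set is the complement in
`{1, …, k - 1}` of that of `R`. -/
def IsComplement (R R' : Ribbon) : Prop :=
  R'.size = R.size ∧ R'.descentSet = Finset.Icc 1 (R.size - 1) \ R.descentSet

/-- The ribbon operator `S^R = s_{μ^rc}^⊥ S̃_{μ'_1} S̃_{μ'_2} ⋯`, where `R = μ / μ^rc` and
`μ'_1, μ'_2, …` are the lengths of the columns of `μ`. The product is composition. -/
def operator (R : Ribbon) : Sym →ₗ[ℚ] Sym :=
  skew (schur (rc R.outer)) ∘ₗ
    ((List.range (R.outer.rowLen 0)).map fun j =>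
      (STilde (R.outer.colLen j : ℤ) : Module.End ℚ Sym)).prod

end Ribbon

/-- `k`-level equality of operators: they agree on the Schur functions of the partitions with
at most `k` parts. -/
def KLevelEq (k : ℕ) (U V : Sym →ₗ[ℚ] Sym) : Prop :=
  ∀ ν : YoungDiagram, ν.colLen 0 ≤ k → U (schur ν) = V (schur ν)

end

end RibbonOps

namespace RibbonOps

open MvPolynomial

/-! ### Skewing by power sums -/

/-! Everything is reduced to one determinant. Write `s` for the number of columns of `ν` and put `x
i = ν'_i - i - 1`, with columns counted from `0`. The dual Jacobi–Trudi formula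
(`schur_eq_omega_jacobiTrudi`) makes `s_ν` the image under `ω` of the determinant with entries `h_{x
i + 1 + j}`. On such determinants a Bernstein operator prepends a row (`S_jacobiTrudi`), and skewing
by a Schur function shifts the column labels (`skew_jacobiTrudi`). So a ribbon operator yields a
determinant in `h_{row label - column label}`. Its fixed row labels are the shifted column lengths
`k = d_0 > d_1 > ⋯ > d_r`, and its column labels are `d_1, …, d_r, 0, -1, …, -s`.

Padding with unit rows lets both kinds of label run over the whole window `[-s, k]`
(`det_eq_ribbonDet`). The result is `ribbonDet`: an `h`-row at each element of the code `D = {d_1,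
…, d_r}`, a unit row elsewhere in `[1, k]`, the row of label `k` placed at `0`, and the free rows at
negative positions.

For the hat, `h_m[X - Y]` is a convolution of `h` in `X` with signed `e` in `Y`. The operator turns
the `Y`-part into a `ribbonDet` in the `e`'s, which is multilinear in the free rows. After setting
`Y = X`, the sum in each free row is a product of inverse Toeplitz matrices, so the row collapses to
a signed unit vector at `x i`. Right multiplication by the unimodular Toeplitz matrix of the `h`'s
then exchanges `e`-rows with unit rows and unit rows with `h`-rows. This complements `D`, and
swapping positions `0` and `k` costs a sign (`sum_ribbonRow_mul_toeplitz`, `det_unit_rows`,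
`hat_jacobiTrudi`).

It remains to read `D` off the ribbon. The code is the reversed complement of the descent set
(`mem_descentSet_iff`), so complementing one complements the other. Every subset of `[1, k - 1]` is
the code of exactly one ribbon of size `k`. The signs agree because the widths of the two ribbons
add up to `k - 1`. -/

theorem z_add_single (n : ℕ+ →₀ ℕ) (k : ℕ+) :
    z (n + Finsupp.single k 1) = z n * (((k : ℕ) : ℚ) * ((n k : ℚ) + 1)) := by
  classical
  have key : ∀ m : ℕ+ →₀ ℕ, z m = (((k : ℕ) : ℚ) ^ m k * ((m k).factorial : ℚ)) * z (m.erase k) := by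
    intro m
    exact (Finsupp.mul_prod_erase' m k (fun (i : ℕ+) (a : ℕ) =>
      ((i : ℕ) : ℚ) ^ a * (a.factorial : ℚ)) (fun _ => by simp)).symm
  have he : (n + Finsupp.single k 1).erase k = n.erase k := by
    ext i
    by_cases hi : i = k
    · subst hi; simp
    · simp [Finsupp.erase_ne hi]
  rw [key, key n, he]
  simp only [Finsupp.add_apply, Finsupp.single_eq_same, pow_succ, Nat.factorial_succ]
  push_cast
  ring

theorem monomial_eq_smul (n : ℕ+ →₀ ℕ) (a : ℚ) :
    (monomial n a : Sym) = a • (monomial n 1 : Sym) := by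
  rw [smul_monomial, smul_eq_mul, mul_one]

/-- Adding a part `k` multiplies `z` by `k` times the new multiplicity, which is `k` times the
exponent brought down by the derivative. Hence `p_k^⊥` is a derivation, and identities can be
checked by induction over the generators. -/
theorem skew_p (k : ℕ+) (f : Sym) : skew (p k) f = ((k : ℕ) : ℚ) • pderiv k f := by
  induction f using MvPolynomial.induction_on' with
  | add f g hf hg => simp only [map_add, smul_add, hf, hg]
  | monomial m a =>
    rw [monomial_eq_smul, map_smul, (pderiv k).map_smul, smul_comm, pderiv_monomial, p, X, skew_monomial]
    congr 1
    split_ifs with hm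
    · obtain ⟨c, rfl⟩ := le_iff_exists_add.1 hm
      rw [add_comm, add_tsub_cancel_right, z_add_single, smul_monomial,
        mul_div_cancel_left₀ _ (z_ne_zero c)]
      simp
    · have : m k = 0 := by
        by_contra hc
        exact hm (by simpa [Finsupp.single_le_iff] using Nat.one_le_iff_ne_zero.2 hc)
      simp [this]

theorem skew_p_mul (k : ℕ+) (f g : Sym) :
    skew (p k) (f * g) = skew (p k) f * g + f * skew (p k) g := by
  simp only [skew_p, Derivation.leibniz, smul_eq_mul, smul_add, mul_smul_comm, smul_mul_assoc]
  ring_nf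

theorem skew_p_p (k j : ℕ+) : skew (p k) (p j) = if j = k then C ((k : ℕ) : ℚ) else 0 := by
  rw [skew_p, p, pderiv_X, Pi.single_apply]
  split_ifs with hjk
  · rw [smul_eq_C_mul, mul_one]
  · rw [smul_zero]

theorem skew_p_C (k : ℕ+) (a : ℚ) : skew (p k) (C a) = 0 := by
  rw [skew_p, pderiv_C, smul_zero]

theorem hall_comm (f g : Sym) : hall f g = hall g f := by
  induction f using MvPolynomial.induction_on' with
  | add f f' hf hf' => simp only [map_add, LinearMap.add_apply, hf, hf']
  | monomial n a =>
  induction g using MvPolynomial.induction_on' with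
  | add f f' hf hf' => simp only [map_add, LinearMap.add_apply, hf, hf']
  | monomial m b =>
    rw [monomial_eq_smul n a, monomial_eq_smul m b]
    simp only [map_smul, LinearMap.smul_apply, hall_monomial, smul_eq_mul]
    by_cases hnm : n = m
    · subst hnm; simp; ring
    · rw [if_neg hnm, if_neg (Ne.symm hnm)]; simp

theorem skew_mul (f g a : Sym) : skew (f * g) a = skew f (skew g a) := by
  refine hall_ext _ _ fun c => ?_
  rw [hall_skew, hall_skew, hall_skew]
  ring_nf

theorem skew_one (a : Sym) : skew 1 a = a :=
  hall_ext _ _ fun c => by rw [hall_skew, one_mul]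

theorem skew_C (r : ℚ) (a : Sym) : skew (C r) a = r • a := by
  rw [← mul_one (C r), ← smul_eq_C_mul, map_smul, LinearMap.smul_apply, skew_one]

/-- The commutator of `g^⊥` with multiplication by `p_k` is `(p_k^⊥ g)^⊥`. -/
theorem skew_p_mul_right (g f : Sym) (k : ℕ+) :
    skew g (f * p k) = skew g f * p k + skew (skew (p k) g) f := by
  refine hall_ext _ _ fun c => ?_
  rw [map_add, LinearMap.add_apply, hall_skew, hall_skew, mul_comm f, mul_comm _ (p k),
    hall_comm, ← hall_skew, skew_p_mul, hall_comm, hall_comm (p k * _), ← hall_skew,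
    hall_comm _ (skew g f), hall_skew, map_add]
  ring

/-! ### The involution -/

/-- The involution `ω` as a homomorphism of algebras. -/
noncomputable def omegaHom : Sym →ₐ[ℚ] Sym :=
  MvPolynomial.aeval fun k : ℕ+ => (-1) ^ ((k : ℕ) - 1) * p k

theorem omega_apply (f : Sym) : omega f = omegaHom f := rfl

theorem omegaHom_p (k : ℕ+) : omegaHom (p k) = (-1) ^ ((k : ℕ) - 1) * p k := by
  rw [omegaHom, p, aeval_X, p]

theorem neg_one_pow_mul_self (n : ℕ) : ((-1) ^ n * (-1) ^ n : Sym) = 1 := by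
  rw [← mul_pow]; simp

theorem omegaHom_omegaHom (f : Sym) : omegaHom (omegaHom f) = f := by
  have : omegaHom.comp omegaHom = AlgHom.id ℚ Sym := by
    refine MvPolynomial.algHom_ext fun k => ?_
    change omegaHom (omegaHom (p k)) = p k
    rw [omegaHom_p, map_mul, omegaHom_p, map_pow, map_neg, map_one, ← mul_assoc,
      neg_one_pow_mul_self, one_mul]
  exact DFunLike.congr_fun this f

theorem omega_omega (f : Sym) : omega (omega f) = f := omegaHom_omegaHom f

theorem skew_neg_one_pow_mul (n : ℕ) (f g : Sym) :
    skew ((-1) ^ n * f) g = (-1) ^ n * skew f g := by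
  rcases neg_one_pow_eq_or Sym n with h | h <;> rw [h] <;> simp

/-- The sign that `ω` puts on `p_k` meets the same sign when `ω g` is differentiated in `p_k`, and
their product is one. -/
theorem skew_omega_p (k : ℕ+) (g : Sym) :
    skew (omegaHom (p k)) (omegaHom g) = omegaHom (skew (p k) g) := by
  rw [omegaHom_p, skew_neg_one_pow_mul]
  induction g using MvPolynomial.induction_on with
  | C a =>
    have : omegaHom (C a) = C a := omegaHom.commutes a
    rw [this, skew_p_C]; simp
  | add f g hf hg => rw [map_add, map_add, mul_add, hf, hg, map_add, map_add]
  | mul_X f j hf =>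
    change (-1) ^ ((k : ℕ) - 1) * skew (p k) (omegaHom (f * p j)) = omegaHom (skew (p k) (f * p j))
    rw [map_mul, skew_p_mul, skew_p_mul, map_add, map_mul, map_mul, ← hf, mul_add, omegaHom_p,
      skew_p_p]
    have hs : ∀ (n : ℕ) (x : Sym), skew (p k) ((-1) ^ n * x) = (-1) ^ n * skew (p k) x := by
      intro n x
      rcases neg_one_pow_eq_or Sym n with h | h <;> rw [h] <;> simp
    rw [hs, skew_p_p]
    split_ifs with hjk
    · subst hjk
      have : omegaHom (C ((j : ℕ) : ℚ)) = C ((j : ℕ) : ℚ) := omegaHom.commutes _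
      rw [this]
      linear_combination (omegaHom f * C ((j : ℕ) : ℚ)) * neg_one_pow_mul_self ((j : ℕ) - 1)
    · simp; ring

theorem skew_omega (f g : Sym) : skew (omega f) (omega g) = omega (skew f g) := by
  simp only [omega_apply]
  induction f using MvPolynomial.induction_on generalizing g with
  | C a =>
    have : omegaHom (C a) = C a := omegaHom.commutes a
    rw [this, skew_C, skew_C, map_smul]
  | add f f' hf hf' => simp only [map_add, LinearMap.add_apply, hf, hf']
  | mul_X f j hf =>
    change skew (omegaHom (f * p j)) _ = omegaHom (skew (f * p j) _)
    rw [map_mul, skew_mul, skew_mul, skew_omega_p, hf]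

/-! ### Recursions for complete and elementary functions -/

theorem h_zero : h 0 = 1 := by rw [h]
theorem e_zero : e 0 = 1 := by rw [e]

theorem h_succ (n : ℕ) : ((n : ℚ) + 1) • h (n + 1) =
    ∑ i ∈ Finset.range (n + 1), p (Nat.succPNat i) * h (n - i) := by
  have : ((n : ℚ) + 1) ≠ 0 := by positivity
  rw [h, smul_smul, mul_one_div_cancel this, one_smul,
    Finset.sum_range (fun i => p (Nat.succPNat i) * h (n - i))]

theorem e_succ (n : ℕ) : ((n : ℚ) + 1) • e (n + 1) =
    ∑ i ∈ Finset.range (n + 1), (-1) ^ i * p (Nat.succPNat i) * e (n - i) := by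
  have : ((n : ℚ) + 1) ≠ 0 := by positivity
  rw [e, smul_smul, mul_one_div_cancel this, one_smul,
    Finset.sum_range (fun i => (-1) ^ i * p (Nat.succPNat i) * e (n - i))]

section Recursion

variable {R : Type*} [CommRing R] [Algebra ℚ R]

/-- The images of the `h_n` under a homomorphism are determined by the images of the `p_k`. -/
theorem map_h_eq (φ : Sym →ₐ[ℚ] R) (g : ℕ → R) (h0 : g 0 = 1)
    (hs : ∀ n : ℕ, ((n : ℚ) + 1) • g (n + 1) =
      ∑ i ∈ Finset.range (n + 1), φ (p (Nat.succPNat i)) * g (n - i)) (n : ℕ) :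
    φ (h n) = g n := by
  induction n using Nat.strong_induction_on with
  | _ n ih =>
  cases n with
  | zero => rw [h_zero, map_one, h0]
  | succ n =>
    have hn : ((n : ℚ) + 1) ≠ 0 := by positivity
    have h1 : ((n : ℚ) + 1) • φ (h (n + 1)) = ((n : ℚ) + 1) • g (n + 1) := by
      rw [hs, ← map_smul, h_succ, map_sum]
      refine Finset.sum_congr rfl fun i _ => ?_
      rw [map_mul, ih (n - i) (by omega)]
    have h2 := congrArg (fun x => ((n : ℚ) + 1)⁻¹ • x) h1
    simpa only [smul_smul, inv_mul_cancel₀ hn, one_smul] using h2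

end Recursion

theorem omegaHom_h (n : ℕ) : omegaHom (h n) = e n := by
  refine map_h_eq omegaHom e e_zero (fun n => ?_) n
  rw [e_succ]
  exact Finset.sum_congr rfl fun i _ => by rw [omegaHom_p, Nat.succPNat_coe, Nat.succ_sub_one]

/-! ### Generating series and sums of alphabets -/

section GeneratingSeries

variable {R : Type*} [CommRing R] [Algebra ℚ R]

/-- The generating series `∑ φ(h_n) T^n`. -/
noncomputable def hSeries (φ : Sym →ₐ[ℚ] R) : PowerSeries R := PowerSeries.mk fun n => φ (h n)

/-- The generating series `∑ φ(p_{n+1}) T^n`. -/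
noncomputable def pSeries (φ : Sym →ₐ[ℚ] R) : PowerSeries R :=
  PowerSeries.mk fun n => φ (p (Nat.succPNat n))

theorem coeff_pSeries_mul (φ : Sym →ₐ[ℚ] R) (G : PowerSeries R) (n : ℕ) :
    PowerSeries.coeff n (pSeries φ * G) =
      ∑ i ∈ Finset.range (n + 1), φ (p (Nat.succPNat i)) * PowerSeries.coeff (n - i) G := by
  rw [PowerSeries.coeff_mul, Finset.Nat.sum_antidiagonal_eq_sum_range_succ_mk]
  exact Finset.sum_congr rfl fun i _ => by rw [pSeries, PowerSeries.coeff_mk]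

/-- This is the recursion `n h_n = ∑ p_i h_{n-i}` read coefficientwise. With constant term one, the
differential equation has a unique solution over `ℚ`, so series can be identified by differentiating
them. -/
theorem derivative_hSeries (φ : Sym →ₐ[ℚ] R) :
    PowerSeries.derivative R (hSeries φ) = pSeries φ * hSeries φ := by
  ext n
  rw [PowerSeries.coeff_derivative, coeff_pSeries_mul]
  have := congrArg φ (h_succ n)
  rw [map_smul, map_sum] at this
  simp only [hSeries, PowerSeries.coeff_mk]
  simp only [map_mul] at this
  rw [← this, Algebra.smul_def, map_add, map_natCast, map_one, mul_comm]

theorem hSeries_eq_of_derivative (φ : Sym →ₐ[ℚ] R) (G : PowerSeries R)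
    (h0 : PowerSeries.coeff 0 G = 1) (hG : PowerSeries.derivative R G = pSeries φ * G) :
    hSeries φ = G := by
  ext n
  rw [hSeries, PowerSeries.coeff_mk]
  refine map_h_eq φ (fun n => PowerSeries.coeff n G) h0 (fun n => ?_) n
  rw [← coeff_pSeries_mul, ← hG, PowerSeries.coeff_derivative, Algebra.smul_def, map_add,
    map_natCast, map_one, mul_comm]

theorem coeff_zero_hSeries (φ : Sym →ₐ[ℚ] R) : PowerSeries.coeff 0 (hSeries φ) = 1 := by
  rw [hSeries, PowerSeries.coeff_mk, h_zero, map_one]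

/-- By the Leibniz rule, logarithmic derivatives add, so the product of the two series solves the
equation of the sum. -/
theorem hSeries_add (φ φ₁ φ₂ : Sym →ₐ[ℚ] R) (hφ : ∀ k, φ (p k) = φ₁ (p k) + φ₂ (p k)) :
    hSeries φ = hSeries φ₁ * hSeries φ₂ := by
  refine hSeries_eq_of_derivative φ _ ?_ ?_
  · simp only [PowerSeries.coeff_zero_eq_constantCoeff, map_mul]
    simp only [← PowerSeries.coeff_zero_eq_constantCoeff, coeff_zero_hSeries, mul_one]
  · have : pSeries φ = pSeries φ₁ + pSeries φ₂ := by
      ext n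
      simp only [pSeries, map_add, PowerSeries.coeff_mk, hφ]
    rw [Derivation.leibniz, derivative_hSeries, derivative_hSeries, this, smul_eq_mul, smul_eq_mul]
    ring

end GeneratingSeries

/-- The antipode `p_k ↦ -p_k`. -/
noncomputable def antipode : Sym →ₐ[ℚ] Sym := MvPolynomial.aeval fun k : ℕ+ => -p k

theorem antipode_p (k : ℕ+) : antipode (p k) = -p k := by
  rw [antipode, p, aeval_X, p]

theorem antipode_h (n : ℕ) : antipode (h n) = (-1) ^ n * e n := by
  refine map_h_eq antipode (fun n => (-1) ^ n * e n) (by simp [e_zero]) (fun n => ?_) n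
  rw [← mul_smul_comm, e_succ, Finset.mul_sum]
  refine Finset.sum_congr rfl fun i hi => ?_
  have hi' : i ≤ n := Nat.lt_succ_iff.1 (Finset.mem_range.1 hi)
  rw [antipode_p]
  obtain ⟨c, rfl⟩ := Nat.exists_eq_add_of_le hi'
  rw [Nat.add_sub_cancel_left]
  linear_combination (-(-1) ^ c * p i.succPNat * e c : Sym) * neg_one_pow_mul_self i

/-- The identity and the antipode add up to zero on power sums, and the series of the zero alphabet
is `1`. -/
theorem sum_h_mul_e (n : ℕ) :
    ∑ x ∈ Finset.HasAntidiagonal.antidiagonal n, h x.1 * ((-1) ^ x.2 * e x.2) = if n = 0 then 1 else 0 := by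
  let φ : Sym →ₐ[ℚ] Sym := MvPolynomial.aeval fun _ : ℕ+ => 0
  have hφ : ∀ k, φ (p k) = 0 := fun k => by simp [φ, p]
  have h1 := hSeries_add φ (AlgHom.id ℚ Sym) antipode (fun k => by
    rw [hφ, antipode_p]; simp)
  have h2 : hSeries φ = 1 := hSeries_eq_of_derivative φ 1 (by simp) (by
    have : pSeries φ = 0 := by ext n; simp [pSeries, hφ]
    rw [this]; simp)
  have h3 := congrArg (PowerSeries.coeff n) (h1.symm.trans h2)
  rw [PowerSeries.coeff_mul, PowerSeries.coeff_one] at h3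
  rw [← h3]
  exact Finset.sum_congr rfl fun x _ => by simp [hSeries, antipode_h]

theorem substDiff_p (k : ℕ+) : substDiff (p k) = p k ⊗ₜ[ℚ] 1 - 1 ⊗ₜ[ℚ] p k := by
  rw [substDiff, p, aeval_X, p]

/-- `X - Y` is the sum of the alphabet `X` and the antipode of `Y`; the antipode turns `h` into
signed `e`. -/
theorem substDiff_h (n : ℕ) : substDiff (h n) =
    ∑ x ∈ Finset.HasAntidiagonal.antidiagonal n, h x.1 ⊗ₜ[ℚ] ((-1) ^ x.2 * e x.2) := by
  have h1 := hSeries_add substDiff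
    (Algebra.TensorProduct.includeLeft : Sym →ₐ[ℚ] Sym ⊗[ℚ] Sym)
    ((Algebra.TensorProduct.includeRight : Sym →ₐ[ℚ] Sym ⊗[ℚ] Sym).comp antipode) (fun k => by
      simp [substDiff_p, antipode_p, TensorProduct.tmul_neg, sub_eq_add_neg])
  have h3 := congrArg (PowerSeries.coeff n) h1
  rw [PowerSeries.coeff_mul, hSeries, PowerSeries.coeff_mk] at h3
  rw [h3]
  exact Finset.sum_congr rfl fun x _ => by simp [hSeries, antipode_h]

/-! ### Integer indices -/

theorem hInt_natCast (n : ℕ) : hInt (n : ℤ) = h n := rfl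

theorem hInt_neg {m : ℤ} (hm : m < 0) : hInt m = 0 := by
  cases m with
  | ofNat n => exact absurd hm (not_lt.2 (Int.natCast_nonneg n))
  | negSucc n => rfl

theorem hInt_zero : hInt 0 = 1 := h_zero

/-- In the recursion for `(n + 1) h_{n+1}`, the derivation hits a power sum only in the term of
`p_k`, giving `k h_{n+1-k}`. The other contributions reassemble into the recursion for `(n + 1 - k)
h_{n+1-k}`, and the coefficients add up to `n + 1`. -/
theorem skew_p_h (k : ℕ+) (n : ℕ) : skew (p k) (h n) = hInt ((n : ℤ) - k) := by
  induction n using Nat.strong_induction_on with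
  | _ n ih =>
  cases n with
  | zero =>
    have : skew (p k) (h 0) = 0 := by rw [h_zero, ← C_1, skew_p_C]
    rw [this, hInt_neg]
    have := k.pos
    push_cast; omega
  | succ n =>
    have hn : ((n : ℚ) + 1) ≠ 0 := by positivity
    have h1 : ((n : ℚ) + 1) • skew (p k) (h (n + 1)) =
        ((n : ℚ) + 1) • hInt (((n + 1 : ℕ) : ℤ) - k) := by
      rw [← map_smul, h_succ, map_sum]
      have h2 : ∀ i ∈ Finset.range (n + 1), skew (p k) (p i.succPNat * h (n - i)) =
          (if i.succPNat = k then C ((k : ℕ) : ℚ) * h (n - i) else 0) +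
            p i.succPNat * hInt ((n : ℤ) - i - k) := by
        intro i hi
        have hi' : i ≤ n := Nat.lt_succ_iff.1 (Finset.mem_range.1 hi)
        rw [skew_p_mul, ih (n - i) (by omega), skew_p_p, Nat.cast_sub hi', ite_mul, zero_mul]
      rw [Finset.sum_congr rfl h2, Finset.sum_add_distrib]
      by_cases hk : (k : ℕ) ≤ n + 1
      · obtain ⟨c, hc⟩ := Nat.exists_eq_add_of_le hk
        have e1 : ∑ i ∈ Finset.range (n + 1),
            (if i.succPNat = k then C ((k : ℕ) : ℚ) * h (n - i) else 0) =
            C ((k : ℕ) : ℚ) * h c := by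
          have hp := k.pos
          rw [Finset.sum_eq_single ((k : ℕ) - 1)]
          · have : ((k : ℕ) - 1).succPNat = k := by
              apply PNat.eq
              simp only [Nat.succPNat_coe]; omega
            rw [if_pos this]
            congr 2; omega
          · intro b _ hb
            rw [if_neg]
            rintro rfl
            simp at hb
          · intro hb
            exact absurd (Finset.mem_range.2 (by omega)) hb
        have e2 : ∑ i ∈ Finset.range (n + 1), p i.succPNat * hInt ((n : ℤ) - i - k) =
            (c : ℚ) • h c := by
          cases c with
          | zero =>
            rw [Nat.cast_zero, zero_smul]
            refine Finset.sum_eq_zero fun i _ => ?_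
            rw [hInt_neg (by omega), mul_zero]
          | succ c =>
            push_cast
            rw [h_succ]
            have hsub : Finset.range (c + 1) ⊆ Finset.range (n + 1) :=
              Finset.range_subset_range.2 (by have := k.pos; omega)
            rw [← Finset.sum_subset hsub]
            · refine Finset.sum_congr rfl fun i hi => ?_
              have := Finset.mem_range.1 hi
              rw [← hInt_natCast]
              congr 2
              omega
            · intro i _ hi
              rw [Finset.mem_range] at hi
              rw [hInt_neg (by omega), mul_zero]
        rw [e1, e2]
        have : (((n + 1 : ℕ) : ℤ) - k) = c := by omega
        rw [this, hInt_natCast, ← smul_eq_C_mul, ← add_smul]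
        congr 1
        have := congrArg (Nat.cast : ℕ → ℚ) hc
        push_cast at this
        linarith
      · rw [hInt_neg (by push_cast; omega), smul_zero, Finset.sum_eq_zero, Finset.sum_eq_zero,
          add_zero]
        · intro i hi
          rw [hInt_neg (by omega), mul_zero]
        · intro i hi
          rw [if_neg]
          rintro rfl
          have := Finset.mem_range.1 hi
          simp at hk
          omega
    have h2 := congrArg (fun x => ((n : ℚ) + 1)⁻¹ • x) h1
    simpa only [smul_smul, inv_mul_cancel₀ hn, one_smul] using h2

theorem skew_p_hInt (k : ℕ+) (m : ℤ) : skew (p k) (hInt m) = hInt (m - k) := by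
  cases m with
  | ofNat n => exact skew_p_h k n
  | negSucc n =>
    have hk := k.pos
    rw [hInt_neg (Int.negSucc_lt_zero n), map_zero, hInt_neg]
    have := Int.negSucc_lt_zero n
    omega

/-! ### Bernstein operators on Jacobi–Trudi determinants -/

theorem skew_p_e (k : ℕ+) (n : ℕ) :
    skew (p k) (e n) = (-1) ^ ((k : ℕ) - 1) * omegaHom (hInt ((n : ℤ) - k)) := by
  have h1 := skew_omega_p k (h n)
  rw [omegaHom_p, omegaHom_h, skew_neg_one_pow_mul, skew_p_h] at h1
  rw [← h1, ← mul_assoc, neg_one_pow_mul_self, one_mul]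

theorem skew_e_one (n : ℕ) : skew (e n) 1 = if n = 0 then 1 else 0 := by
  cases n with
  | zero => rw [e_zero, skew_one, if_pos rfl]
  | succ n =>
    have hn : ((n : ℚ) + 1) ≠ 0 := by positivity
    have h0 : ∀ k, skew (p k) (1 : Sym) = 0 := fun k => by
      rw [← MvPolynomial.C_1, skew_p_C]
    have h1 : ((n : ℚ) + 1) • skew (e (n + 1)) (1 : Sym) = 0 := by
      rw [← LinearMap.smul_apply, ← map_smul, e_succ, map_sum, LinearMap.sum_apply]
      refine Finset.sum_eq_zero fun i _ => ?_
      rw [mul_assoc, skew_neg_one_pow_mul, mul_comm (p _), skew_mul, h0, map_zero, mul_zero]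
    rw [if_neg (Nat.succ_ne_zero n)]
    exact (smul_eq_zero.1 h1).resolve_left hn

/-- The homomorphism `p_k ↦ p_k - (-t)^k`, which is `∑ t^n e_n^⊥`. -/
noncomputable def elemShift : Sym →ₐ[ℚ] Polynomial Sym :=
  MvPolynomial.aeval fun k : ℕ+ => Polynomial.C (p k) - (-Polynomial.X) ^ (k : ℕ)

theorem elemShift_p (k : ℕ+) :
    elemShift (p k) = Polynomial.C (p k) - (-Polynomial.X) ^ (k : ℕ) := by
  rw [elemShift, p, MvPolynomial.aeval_X, p]

/-- Both sides obey the same rule under multiplication by `p_j`: the commutator of `e_n^⊥` with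
`p_j` is `(p_j^⊥ e_n)^⊥`, a signed `e_{n-j}^⊥`, which matches the term `-(-t)^j`. -/
theorem coeff_elemShift (f : Sym) (n : ℕ) : (elemShift f).coeff n = skew (e n) f := by
  induction f using MvPolynomial.induction_on generalizing n with
  | C a =>
    have h1 : elemShift (MvPolynomial.C a) = Polynomial.C (MvPolynomial.C a) :=
      elemShift.commutes a
    have h2 : (MvPolynomial.C a : Sym) = a • 1 := by rw [MvPolynomial.smul_eq_C_mul, mul_one]
    rw [h1, Polynomial.coeff_C, h2, map_smul, skew_e_one]
    split_ifs <;> simp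
  | add f g hf hg => rw [map_add, Polynomial.coeff_add, hf, hg, map_add]
  | mul_X f j hf =>
    change (elemShift (f * p j)).coeff n = skew (e n) (f * p j)
    rw [map_mul, elemShift_p, skew_p_mul_right, skew_p_e, mul_sub, Polynomial.coeff_sub,
      Polynomial.coeff_mul_C, hf]
    have h1 : (-Polynomial.X : Polynomial Sym) ^ (j : ℕ) =
        Polynomial.C ((-1) ^ (j : ℕ)) * Polynomial.X ^ (j : ℕ) := by
      rw [neg_pow (Polynomial.X : Polynomial Sym), Polynomial.C_pow, Polynomial.C_neg, Polynomial.C_1]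
    have h2 : ((-1) ^ (j : ℕ) : Sym) = -(-1) ^ ((j : ℕ) - 1) := by
      obtain ⟨c, hc⟩ := Nat.exists_eq_add_of_lt j.pos
      rw [hc]; simp [pow_succ]
    rw [h1, mul_left_comm, Polynomial.coeff_C_mul, Polynomial.coeff_mul_X_pow', h2,
      skew_neg_one_pow_mul]
    split_ifs with hj
    · rw [hf, ← Nat.cast_sub hj, hInt_natCast, omegaHom_h]
      ring
    · rw [hInt_neg (by omega)]; simp

theorem elemShift_hInt (m : ℤ) : elemShift (hInt m) =
    Polynomial.C (hInt m) + Polynomial.X * Polynomial.C (hInt (m - 1)) := by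
  cases m with
  | negSucc n =>
    have := Int.negSucc_lt_zero n
    rw [hInt_neg this, hInt_neg (by omega)]; simp
  | ofNat n =>
    let φ₁ : Sym →ₐ[ℚ] Polynomial Sym :=
      MvPolynomial.aeval fun k : ℕ+ => Polynomial.C (p k)
    let φ₂ : Sym →ₐ[ℚ] Polynomial Sym :=
      MvPolynomial.aeval fun k : ℕ+ => -(-Polynomial.X) ^ (k : ℕ)
    have h₂p : ∀ k : ℕ+, φ₂ (p k) = -(-Polynomial.X) ^ (k : ℕ) := fun k =>
      MvPolynomial.aeval_X _ _
    have h₁ : ∀ f, φ₁ f = Polynomial.C f := by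
      intro f
      have : φ₁ = (Polynomial.CAlgHom : Sym →ₐ[Sym] Polynomial Sym).restrictScalars ℚ := MvPolynomial.algHom_ext fun k => by
        exact (MvPolynomial.aeval_X (R := ℚ) (S₁ := Polynomial Sym) _ k)
      rw [this]; rfl
    -- The added alphabet has series `1 + tT`, so only `h_0` and `h_1` survive; in higher degrees
    -- the last two terms of the recursion cancel.
    have h₂ : ∀ n, φ₂ (h n) = if n = 0 then 1 else if n = 1 then Polynomial.X else 0 := by
      refine map_h_eq φ₂ _ rfl fun n => ?_
      have hp : ∀ i : ℕ, φ₂ (p i.succPNat) = -(-Polynomial.X) ^ (i + 1) := fun i => by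
        rw [h₂p, Nat.succPNat_coe]
      cases n with
      | zero => simp [hp]
      | succ n =>
        rw [Finset.sum_range_succ, Finset.sum_range_succ, Finset.sum_eq_zero]
        · simp [hp]; ring
        · intro i hi
          have := Finset.mem_range.1 hi
          rw [if_neg (by omega), if_neg (by omega), mul_zero]
    have h3 := congrArg (PowerSeries.coeff n) (hSeries_add elemShift φ₁ φ₂ fun k => by
      rw [h₁, elemShift_p, sub_eq_add_neg]
      exact congrArg (Polynomial.C (p k) + ·) (h₂p k).symm)
    rw [hSeries, PowerSeries.coeff_mk, PowerSeries.coeff_mul] at h3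
    change elemShift (h n) = _
    rw [h3]
    simp only [hSeries, PowerSeries.coeff_mk, h₁, h₂]
    cases n with
    | zero => simp [hInt_neg, h_zero, hInt_zero]
    | succ n =>
      rw [Finset.Nat.sum_antidiagonal_succ', Finset.Nat.sum_antidiagonal_eq_sum_range_succ_mk,
        Finset.sum_range_succ, Finset.sum_eq_zero]
      · have h4 : (Int.ofNat (n + 1) - 1) = ((n : ℕ) : ℤ) := by
          simp
        rw [h4, hInt_natCast]
        change _ = Polynomial.C (h (n + 1)) + _
        simp
      · intro i hi
        have := Finset.mem_range.1 hi
        rw [if_neg (by omega), if_neg (by omega), mul_zero]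

/-- The linear map `t^k ↦ (-1)^k h_{m+k}`. -/
noncomputable def bernsteinFunctional (m : ℤ) : Polynomial Sym →ₗ[Sym] Sym :=
  (Polynomial.basisMonomials Sym).constr Sym fun k => (-1) ^ k * hInt (m + k)

theorem bernsteinFunctional_X_pow (m : ℤ) (k : ℕ) :
    bernsteinFunctional m (Polynomial.X ^ k) = (-1) ^ k * hInt (m + k) := by
  have := (Polynomial.basisMonomials Sym).constr_basis Sym
    (fun k : ℕ => (-1) ^ k * hInt (m + k)) k
  rw [Polynomial.coe_basisMonomials] at this
  simp only [Polynomial.monomial_one_right_eq_X_pow] at this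
  exact this

theorem S_apply (m : ℤ) (f : Sym) : S m f = bernsteinFunctional m (elemShift f) := by
  change ∑ᶠ k : ℕ, bernsteinTerm m f k = _
  rw [finsum_eq_sum_of_support_subset (s := (elemShift f).support)]
  · conv_rhs => rw [(elemShift f).as_sum_support_C_mul_X_pow]
    rw [map_sum]
    refine Finset.sum_congr rfl fun k _ => ?_
    rw [← Polynomial.smul_eq_C_mul, map_smul, bernsteinFunctional_X_pow, coeff_elemShift,
      bernsteinTerm, smul_eq_mul, mul_comm]
  · intro k hk
    rw [Finset.mem_coe, Polynomial.mem_support_iff, coeff_elemShift]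
    intro hc
    exact hk (by rw [bernsteinTerm, hc, mul_zero])

/-- The determinant `det (h_{b_i + j})` of size `n`, with `i, j` counted from `0`. -/
noncomputable def jacobiTrudi (n : ℕ) (b : ℕ → ℤ) : Sym :=
  Matrix.det (Matrix.of fun i j : Fin n => hInt (b i + (j : ℕ)))

theorem jacobiTrudi_congr (n : ℕ) (b c : ℕ → ℤ) (hbc : ∀ i < n, b i = c i) :
    jacobiTrudi n b = jacobiTrudi n c := by
  unfold jacobiTrudi
  congr 1
  ext1 i j
  simp only [Matrix.of_apply, hbc i i.2]

/-- Adding `t` times each column of the bordered matrix to the next reduces the top row to `(1, 0,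
…, 0)` and replaces `h_m` by `h_m + t h_{m-1}`, the shift of `h_m`. Keeping the border confines `t`
to one row. -/
theorem elemShift_jacobiTrudi (n : ℕ) (b : ℕ → ℤ) :
    elemShift (jacobiTrudi n b) =
      Matrix.det (Matrix.of fun i j : Fin (n + 1) =>
        (Fin.cons ((-Polynomial.X) ^ (j : ℕ))
          (fun i : Fin n => Polynomial.C (hInt (b i - 1 + (j : ℕ)))) : Fin (n + 1) → Polynomial Sym)
          i) := by
  symm
  rw [Matrix.det_eq_of_forall_col_eq_smul_add_pred (B := Matrix.of fun i j : Fin (n + 1) =>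
    (Fin.cons (if j = 0 then 1 else 0)
      (fun i : Fin n => if j = 0 then Polynomial.C (hInt (b i - 1)) else
        Polynomial.C (hInt (b i - 1 + (j : ℕ))) +
          Polynomial.X * Polynomial.C (hInt (b i - 1 + (j : ℕ) - 1))) :
        Fin (n + 1) → Polynomial Sym) i) (fun _ => -Polynomial.X)]
  · rw [Matrix.det_succ_row_zero, Finset.sum_eq_single 0]
    · simp only [Fin.val_zero, pow_zero, Matrix.of_apply, Fin.cons_zero, if_true, one_mul,
        jacobiTrudi]
      rw [AlgHom.map_det]
      congr 1
      ext1 i j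
      simp only [Matrix.submatrix_apply, Matrix.of_apply, Fin.cons_succ, Fin.succAbove_zero,
        Fin.succ_ne_zero, if_false, AlgHom.mapMatrix_apply, Matrix.map_apply, elemShift_hInt,
        Fin.val_succ]
      have h1 : b i - 1 + ((j + 1 : ℕ) : ℤ) = b i + (j : ℕ) := by push_cast; ring
      rw [h1]
    · intro j _ hj
      simp [hj]
    · simp
  · intro i
    refine Fin.cases ?_ (fun i => ?_) i <;> simp
  · intro i j
    refine Fin.cases ?_ (fun i => ?_) i
    · simp only [Matrix.of_apply, Fin.cons_zero, Fin.succ_ne_zero, if_false, Fin.val_succ,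
        Fin.val_castSucc, pow_succ, zero_add]
      exact mul_comm _ _
    · simp only [Matrix.of_apply, Fin.cons_succ, Fin.succ_ne_zero, if_false, Fin.val_succ,
        Fin.val_castSucc]
      have : (b i - 1 + ((j + 1 : ℕ) : ℤ) - 1) = b i - 1 + (j : ℕ) := by push_cast; ring
      rw [this]
      ring

/-- A Bernstein operator prepends a row to a Jacobi–Trudi determinant. -/
theorem S_jacobiTrudi (m : ℤ) (n : ℕ) (b : ℕ → ℤ) :
    S m (jacobiTrudi n b) =
      jacobiTrudi (n + 1) (fun i => if i = 0 then m else b (i - 1) - 1) := by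
  -- Both determinants are expanded along the top row. The other rows are free of `t`, so the
  -- functional sees only `(-t)^j`, which it sends to `h_{m+j}`.
  rw [S_apply, elemShift_jacobiTrudi, jacobiTrudi, Matrix.det_succ_row_zero,
    Matrix.det_succ_row_zero, map_sum]
  refine Finset.sum_congr rfl fun k _ => ?_
  have h1 : (Matrix.submatrix (Matrix.of fun i j : Fin (n + 1) =>
        (Fin.cons ((-Polynomial.X) ^ (j : ℕ))
          (fun i : Fin n => Polynomial.C (hInt (b i - 1 + (j : ℕ)))) : Fin (n + 1) → Polynomial Sym)
          i) Fin.succ k.succAbove) =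
      Polynomial.C.mapMatrix (Matrix.submatrix (Matrix.of fun i j : Fin (n + 1) =>
        hInt ((if (i : ℕ) = 0 then m else b (i - 1) - 1) + (j : ℕ))) Fin.succ k.succAbove) := by
    ext1 i j
    simp
  rw [h1, ← RingHom.map_det]
  simp only [Matrix.of_apply, Fin.cons_zero, Fin.val_zero, if_true]
  rw [mul_comm, ← Polynomial.smul_eq_C_mul, map_smul]
  have h2 : ((-1) ^ (k : ℕ) * (-Polynomial.X) ^ (k : ℕ) : Polynomial Sym) =
      Polynomial.X ^ (k : ℕ) := by
    rw [neg_pow (Polynomial.X : Polynomial Sym), ← mul_assoc, ← mul_pow]; simp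
  rw [h2, bernsteinFunctional_X_pow, smul_eq_mul, mul_comm]

/-- A product of column operators, on a determinant in the `e_n`. -/
theorem prod_STilde_jacobiTrudi (r : ℕ) (a : ℕ → ℤ) (s : ℕ) (b : ℕ → ℤ) :
    ((List.range r).map fun j => (STilde (a j) : Module.End ℚ Sym)).prod
        (omega (jacobiTrudi s b)) =
      omega (jacobiTrudi (s + r) fun i => if i < r then a i - i else b (i - r) - r) := by
  induction r generalizing a with
  | zero => simp
  | succ r ih =>
    rw [List.range_succ_eq_map, List.map_cons, List.prod_cons, List.map_map, Module.End.mul_apply]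
    have := ih (fun j => a (j + 1))
    simp only [Function.comp_def, Nat.succ_eq_add_one]
    rw [this]
    change omega (S (a 0) (omega (omega _))) = _
    rw [omega_omega, S_jacobiTrudi]
    congr 1
    refine jacobiTrudi_congr _ _ _ fun i _ => ?_
    rcases i with _ | i
    · simp
    · simp only [Nat.succ_ne_zero, if_false, Nat.add_sub_cancel, Nat.add_lt_add_iff_right,
        Nat.add_sub_add_right]
      split_ifs <;> (push_cast; ring)

/-! ### Skewing Jacobi–Trudi determinants -/

theorem skew_p_prod {ι : Type*} [DecidableEq ι] (k : ℕ+) (s : Finset ι) (f : ι → Sym) :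
    skew (p k) (∏ i ∈ s, f i) =
      ∑ j ∈ s, ∏ i ∈ s, if i = j then skew (p k) (f i) else f i := by
  induction s using Finset.induction_on with
  | empty => rw [Finset.prod_empty, Finset.sum_empty, ← MvPolynomial.C_1, skew_p_C]
  | insert a s ha ih =>
    rw [Finset.prod_insert ha, skew_p_mul, ih, Finset.sum_insert ha, Finset.prod_insert ha,
      if_pos rfl, Finset.mul_sum]
    congr 1
    · congr 1
      exact Finset.prod_congr rfl fun i hi => by rw [if_neg (ne_of_mem_of_not_mem hi ha)]
    · refine Finset.sum_congr rfl fun j hj => ?_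
      rw [Finset.prod_insert ha, if_neg (ne_of_mem_of_not_mem hj ha).symm]

/-! ### Alternants in finitely many variables -/

section Alphabet

variable {n : ℕ}

/-- The linear map that sends `x^γ` to `det (h_{β_i - γ_j})`. -/
noncomputable def columnMap (β : Fin n → ℤ) : MvPolynomial (Fin n) ℚ →ₗ[ℚ] Sym :=
  (MvPolynomial.basisMonomials (Fin n) ℚ).constr ℚ fun γ =>
    Matrix.det (Matrix.of fun i j : Fin n => hInt (β i - (γ j : ℕ)))

theorem columnMap_monomial (β : Fin n → ℤ) (γ : Fin n →₀ ℕ) :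
    columnMap β (MvPolynomial.monomial γ 1) =
      Matrix.det (Matrix.of fun i j : Fin n => hInt (β i - (γ j : ℕ))) := by
  have := (MvPolynomial.basisMonomials (Fin n) ℚ).constr_basis ℚ
    (fun γ => Matrix.det (Matrix.of fun i j : Fin n => hInt (β i - (γ j : ℕ)))) γ
  rw [MvPolynomial.coe_basisMonomials] at this
  exact this

/-- Two linear maps on polynomials agree if they agree on monomials. -/
theorem linearMap_ext_monomial {σ M : Type*} [AddCommMonoid M] [Module ℚ M]
    (F G : MvPolynomial σ ℚ →ₗ[ℚ] M)
    (hFG : ∀ γ, F (MvPolynomial.monomial γ 1) = G (MvPolynomial.monomial γ 1)) : F = G :=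
  (MvPolynomial.basisMonomials σ ℚ).ext fun γ => by
    rw [MvPolynomial.coe_basisMonomials]; exact hFG γ

/-- The specialization of symmetric functions to `n` variables. -/
noncomputable def toVars (n : ℕ) : Sym →ₐ[ℚ] MvPolynomial (Fin n) ℚ :=
  MvPolynomial.aeval fun k : ℕ+ => ∑ i, MvPolynomial.X i ^ (k : ℕ)

theorem toVars_p (k : ℕ+) :
    toVars n (p k) = ∑ i, MvPolynomial.X i ^ (k : ℕ) := by
  rw [toVars, p, MvPolynomial.aeval_X]

/-- As a derivation lowering every `h`-index by `k`, `p_k^⊥` lowers the columns of the determinant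
one at a time. Lowering column `j` is multiplication by `x_j^k`. -/
theorem skew_p_columnMap (β : Fin n → ℤ) (k : ℕ+) (g : MvPolynomial (Fin n) ℚ) :
    skew (p k) (columnMap β g) = columnMap β (toVars n (p k) * g) := by
  have key : skew (p k) ∘ₗ columnMap β =
      columnMap β ∘ₗ LinearMap.mulLeft ℚ (toVars n (p k)) := by
    refine linearMap_ext_monomial _ _ fun γ => ?_
    simp only [LinearMap.comp_apply, LinearMap.mulLeft_apply]
    rw [toVars_p, Finset.sum_mul, map_sum]
    have h1 : ∀ j : Fin n, MvPolynomial.X j ^ (k : ℕ) * MvPolynomial.monomial γ (1 : ℚ) =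
        MvPolynomial.monomial (Finsupp.single j (k : ℕ) + γ) 1 := fun j => by
      rw [MvPolynomial.X_pow_eq_monomial, MvPolynomial.monomial_mul, one_mul]
    simp only [h1, columnMap_monomial, Matrix.det_apply, map_sum, Units.smul_def, map_zsmul]
    rw [Finset.sum_comm]
    refine Finset.sum_congr rfl fun σ _ => ?_
    rw [skew_p_prod, Finset.smul_sum]
    refine Finset.sum_congr rfl fun j _ => ?_
    congr 1
    refine Finset.prod_congr rfl fun i _ => ?_
    simp only [Matrix.of_apply, Finsupp.add_apply, skew_p_hInt]
    by_cases hij : i = j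
    · subst hij
      rw [if_pos rfl, Finsupp.single_eq_same]
      congr 1; push_cast; ring
    · rw [if_neg hij, Finsupp.single_eq_of_ne hij, zero_add]
  exact LinearMap.congr_fun key g

theorem skew_columnMap (β : Fin n → ℤ) (f : Sym) (g : MvPolynomial (Fin n) ℚ) :
    skew f (columnMap β g) = columnMap β (toVars n f * g) := by
  induction f using MvPolynomial.induction_on generalizing g with
  | C a =>
    have : toVars n (MvPolynomial.C a) = MvPolynomial.C a := (toVars n).commutes a
    rw [this, skew_C, ← MvPolynomial.smul_eq_C_mul, map_smul]
  | add f f' hf hf' => simp only [map_add, LinearMap.add_apply, add_mul, hf, hf']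
  | mul_X f j hf =>
    change skew (f * p j) _ = columnMap β (toVars n (f * p j) * g)
    rw [skew_mul, skew_p_columnMap, hf, map_mul (toVars n), mul_assoc]

theorem columnMap_rename (β : Fin n → ℤ) (σ : Equiv.Perm (Fin n)) (g : MvPolynomial (Fin n) ℚ) :
    columnMap β (MvPolynomial.rename σ g) = (Equiv.Perm.sign σ : ℤ) • columnMap β g := by
  have key : columnMap β ∘ₗ (MvPolynomial.rename σ).toLinearMap =
      (Equiv.Perm.sign σ : ℤ) • columnMap β := by
    refine linearMap_ext_monomial _ _ fun γ => ?_
    rw [LinearMap.comp_apply, LinearMap.smul_apply, AlgHom.toLinearMap_apply,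
      MvPolynomial.rename_monomial, columnMap_monomial, columnMap_monomial]
    have h1 : (Matrix.of fun i j : Fin n => hInt (β i - (Finsupp.mapDomain σ γ j : ℕ))) =
        (Matrix.of fun i j : Fin n => hInt (β i - (γ j : ℕ))).submatrix id (σ⁻¹ : Equiv.Perm (Fin n)) := by
      ext1 i j
      simp only [Matrix.of_apply, Matrix.submatrix_apply, id]
      obtain ⟨j, rfl⟩ := σ.surjective j
      rw [Finsupp.mapDomain_apply σ.injective, Equiv.Perm.coe_inv, Equiv.symm_apply_apply]
    rw [h1, Matrix.det_permute', Equiv.Perm.sign_inv, zsmul_eq_mul]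
  exact LinearMap.congr_fun key g

theorem rename_toVars (σ : Equiv.Perm (Fin n)) (f : Sym) :
    MvPolynomial.rename σ (toVars n f) = toVars n f := by
  have : (MvPolynomial.rename σ).comp (toVars n) = toVars n := by
    refine MvPolynomial.algHom_ext fun k => ?_
    change MvPolynomial.rename σ (toVars n (p k)) = toVars n (p k)
    rw [toVars_p, map_sum]
    simp only [map_pow, MvPolynomial.rename_X]
    exact Equiv.sum_comp σ fun i => (MvPolynomial.X i : MvPolynomial (Fin n) ℚ) ^ (k : ℕ)
  exact DFunLike.congr_fun this f

/-- The alternant `det (x_i^{t_l})`. -/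
noncomputable def alternant (t : Fin n → ℕ) : MvPolynomial (Fin n) ℚ :=
  Matrix.det (Matrix.of fun l i : Fin n => MvPolynomial.X i ^ t l)

theorem monomial_eq_prod (t : Fin n → ℕ) :
    (MvPolynomial.monomial (Finsupp.equivFunOnFinite.symm t) 1 : MvPolynomial (Fin n) ℚ) =
      ∏ l, MvPolynomial.X l ^ t l := by
  rw [MvPolynomial.monomial_eq, Finsupp.prod_fintype _ _ (by simp)]
  simp

/-- A permutation of the variables permutes the columns of the determinant, while the symmetric
factor is unchanged. The two signs cancel, so all `n!` terms of the alternant contribute equally. -/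
theorem columnMap_alternant (β : Fin n → ℤ) (t : Fin n → ℕ) (f : Sym) :
    columnMap β (toVars n f * alternant t) =
      (n.factorial : ℚ) • columnMap β
        (toVars n f * MvPolynomial.monomial (Finsupp.equivFunOnFinite.symm t) 1) := by
  have h1 : alternant t = ∑ σ : Equiv.Perm (Fin n), (Equiv.Perm.sign σ : ℤ) •
      MvPolynomial.rename σ (MvPolynomial.monomial (Finsupp.equivFunOnFinite.symm t) (1 : ℚ)) := by
    rw [alternant, ← Matrix.det_transpose, Matrix.det_apply]
    refine Finset.sum_congr rfl fun σ _ => ?_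
    rw [monomial_eq_prod, map_prod, Units.smul_def]
    simp
  rw [h1, Finset.mul_sum, map_sum]
  have h2 : ∀ σ : Equiv.Perm (Fin n), columnMap β (toVars n f * (Equiv.Perm.sign σ : ℤ) •
      MvPolynomial.rename σ (MvPolynomial.monomial (Finsupp.equivFunOnFinite.symm t) (1 : ℚ))) =
      columnMap β
        (toVars n f * MvPolynomial.monomial (Finsupp.equivFunOnFinite.symm t) 1) := by
    intro σ
    rw [mul_smul_comm, map_zsmul]
    conv_lhs => rw [← rename_toVars σ f, ← map_mul, columnMap_rename, smul_smul]
    rw [← Units.val_mul, ← sq, Int.units_sq, Units.val_one, one_smul]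
  rw [Finset.sum_congr rfl fun σ _ => h2 σ, Finset.sum_const, Finset.card_univ, Fintype.card_perm,
    Fintype.card_fin, ← Nat.cast_smul_eq_nsmul ℚ]

/-- The geometric series `∑ y^n T^n`. -/
noncomputable def geomSeries {R : Type*} [CommRing R] (y : R) : PowerSeries R :=
  PowerSeries.mk fun n => y ^ n

theorem geomSeries_mul {R : Type*} [CommRing R] (y : R) :
    geomSeries y * (1 - PowerSeries.C y * PowerSeries.X) = 1 := by
  ext n
  rw [mul_sub, mul_one, ← mul_assoc, mul_comm _ (PowerSeries.C y), mul_assoc, map_sub]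
  cases n with
  | zero => simp [geomSeries]
  | succ n =>
    rw [PowerSeries.coeff_C_mul, PowerSeries.coeff_succ_mul_X, PowerSeries.coeff_one]
    simp [geomSeries, pow_succ, mul_comm]

theorem hSeries_sum_pow {R : Type*} [CommRing R] [Algebra ℚ R] {ι : Type*} [DecidableEq ι]
    (s : Finset ι) (y : ι → R) (φ : Sym →ₐ[ℚ] R)
    (hφ : ∀ k, φ (p k) = ∑ i ∈ s, y i ^ (k : ℕ)) :
    hSeries φ = ∏ i ∈ s, geomSeries (y i) := by
  induction s using Finset.induction_on generalizing φ with
  | empty =>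
    rw [Finset.prod_empty]
    refine hSeries_eq_of_derivative φ 1 (by simp) ?_
    have : pSeries φ = 0 := by ext n; simp [pSeries, hφ]
    rw [this]; simp
  | insert a s ha ih =>
    let φ₁ : Sym →ₐ[ℚ] R := MvPolynomial.aeval fun k : ℕ+ => y a ^ (k : ℕ)
    let φ₂ : Sym →ₐ[ℚ] R := MvPolynomial.aeval fun k : ℕ+ => ∑ i ∈ s, y i ^ (k : ℕ)
    have h₁ : ∀ k, φ₁ (p k) = y a ^ (k : ℕ) := fun k => MvPolynomial.aeval_X _ _
    have h₂ : ∀ k, φ₂ (p k) = ∑ i ∈ s, y i ^ (k : ℕ) := fun k => MvPolynomial.aeval_X _ _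
    rw [Finset.prod_insert ha, hSeries_add φ φ₁ φ₂ fun k => by
      rw [hφ, Finset.sum_insert ha, h₁, h₂], ih φ₂ h₂]
    congr 1
    ext n
    rw [hSeries, geomSeries, PowerSeries.coeff_mk, PowerSeries.coeff_mk]
    refine map_h_eq φ₁ (fun n => y a ^ n) (pow_zero _) (fun n => ?_) n
    have : ∀ i ∈ Finset.range (n + 1), φ₁ (p i.succPNat) * y a ^ (n - i) = y a ^ (n + 1) := by
      intro i hi
      have := Finset.mem_range.1 hi
      rw [h₁, Nat.succPNat_coe, ← pow_add]
      congr 1; omega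
    rw [Finset.sum_congr rfl this, Finset.sum_const, Finset.card_range, ← Nat.cast_smul_eq_nsmul ℚ]
    push_cast; rfl

/-- The product of `1 - x_m T` over `m ≠ i`. -/
noncomputable def cofactorPoly (i : Fin n) : Polynomial (MvPolynomial (Fin n) ℚ) :=
  ∏ m ∈ Finset.univ.erase i, (1 - Polynomial.C (MvPolynomial.X m) * Polynomial.X)

theorem natDegree_cofactorPoly (i : Fin n) : (cofactorPoly i).natDegree < n := by
  have h1 : (cofactorPoly i).natDegree ≤ ∑ m ∈ Finset.univ.erase i, 1 := by
    refine (Polynomial.natDegree_prod_le _ _).trans (Finset.sum_le_sum fun m _ => ?_)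
    compute_degree
  have := i.pos
  simp at h1
  omega

theorem hSeries_mul_cofactorPoly (i : Fin n) :
    hSeries (toVars n) * (cofactorPoly i : PowerSeries (MvPolynomial (Fin n) ℚ)) =
      geomSeries (MvPolynomial.X i) := by
  have h1 : (cofactorPoly i : PowerSeries (MvPolynomial (Fin n) ℚ)) =
      ∏ m ∈ Finset.univ.erase i, (1 - PowerSeries.C (MvPolynomial.X m) * PowerSeries.X) := by
    rw [cofactorPoly, ← Polynomial.coeToPowerSeries.ringHom_apply, map_prod]
    simp
  rw [h1, hSeries_sum_pow Finset.univ MvPolynomial.X (toVars n) fun k => toVars_p k,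
    ← Finset.mul_prod_erase _ _ (Finset.mem_univ i), mul_assoc, ← Finset.prod_mul_distrib,
    Finset.prod_congr rfl fun m _ => geomSeries_mul (MvPolynomial.X m), Finset.prod_const_one,
    mul_one]

/-- Compare coefficients of `T^t` in the factorization that isolates `1/(1 - x_i T)`; the cofactor
has degree below `n`, so `n` terms suffice. -/
theorem sum_toVars_mul_cofactorPoly (i : Fin n) (t : ℕ) :
    ∑ j : Fin n, toVars n (hInt ((t : ℤ) - (n - 1 - (j : ℕ) : ℕ))) *
      (cofactorPoly i).coeff (n - 1 - (j : ℕ)) = MvPolynomial.X i ^ t := by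
  rw [Fin.sum_univ_eq_sum_range (fun j => toVars n (hInt ((t : ℤ) - (n - 1 - j : ℕ))) *
      (cofactorPoly i).coeff (n - 1 - j)) n,
    Finset.sum_range_reflect (fun b => toVars n (hInt ((t : ℤ) - (b : ℕ))) *
      (cofactorPoly i).coeff b) n]
  have h1 := congrArg (PowerSeries.coeff t) (hSeries_mul_cofactorPoly i)
  rw [mul_comm, PowerSeries.coeff_mul, Finset.Nat.sum_antidiagonal_eq_sum_range_succ_mk] at h1
  simp only [hSeries, geomSeries, PowerSeries.coeff_mk, Polynomial.coeff_coe] at h1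
  rw [← h1]
  have hs1 : Finset.range n ⊆ Finset.range (n + t + 1) := Finset.range_subset_range.2 (by omega)
  have hs2 : Finset.range (t + 1) ⊆ Finset.range (n + t + 1) :=
    Finset.range_subset_range.2 (by omega)
  rw [Finset.sum_subset hs1]
  · symm
    rw [← Finset.sum_subset hs2]
    · refine Finset.sum_congr rfl fun b hb => ?_
      have := Finset.mem_range.1 hb
      rw [← Nat.cast_sub (by omega), hInt_natCast, mul_comm]
    · intro b _ hb
      rw [Finset.mem_range] at hb
      rw [hInt_neg (by omega), map_zero, zero_mul]
  · intro b _ hb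
    rw [Finset.mem_range] at hb
    rw [Polynomial.coeff_eq_zero_of_natDegree_lt, mul_zero]
    have := natDegree_cofactorPoly i
    omega

theorem jacobiTrudi_neg (n : ℕ) : jacobiTrudi n (fun l => -(l : ℤ)) = 1 := by
  rw [jacobiTrudi, Matrix.det_of_isUpperTriangular]
  · simp [hInt_zero]
  · intro i j hij
    have : (j : ℕ) < (i : ℕ) := hij
    simp only [Matrix.of_apply]
    exact hInt_neg (by omega)

/-- The bialternant formula. -/
theorem toVars_jacobiTrudi_mul_alternant (t : Fin n → ℕ) (c : ℕ → ℤ)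
    (hc : ∀ l : Fin n, (t l : ℤ) = c l + (n - 1)) :
    toVars n (jacobiTrudi n c) * alternant (fun l : Fin n => n - 1 - (l : ℕ)) =
      alternant t := by
  have key : ∀ (t : Fin n → ℕ) (c : ℕ → ℤ), (∀ l : Fin n, (t l : ℤ) = c l + (n - 1)) →
      toVars n (jacobiTrudi n c) *
        Matrix.det (Matrix.of fun j i : Fin n => (cofactorPoly i).coeff (n - 1 - (j : ℕ))) =
      alternant t := by
    intro t c hc
    rw [jacobiTrudi, AlgHom.map_det, ← Matrix.det_mul, alternant]
    congr 1
    ext1 l i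
    rw [Matrix.mul_apply, Matrix.of_apply, ← sum_toVars_mul_cofactorPoly]
    refine Finset.sum_congr rfl fun j _ => ?_
    simp only [AlgHom.mapMatrix_apply, Matrix.map_apply, Matrix.of_apply]
    congr 3
    have := hc l
    have := j.2
    omega
  -- Applying the factorization to the staircase as well, where the Jacobi–Trudi determinant is
  -- unitriangular, identifies the cofactor determinant with the staircase alternant.
  rw [← key t c hc, ← key _ (fun l => -(l : ℤ)) (fun l => by have := l.2; omega), jacobiTrudi_neg,
    map_one, one_mul]

end Alphabet

/-- The skew Jacobi–Trudi formula. -/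
theorem skew_jacobiTrudi (n : ℕ) (b c : ℕ → ℤ) (hc : ∀ l < n, 0 ≤ c l + (n - 1)) :
    skew (jacobiTrudi n c) (jacobiTrudi n b) =
      Matrix.det (Matrix.of fun i l : Fin n => hInt (b i - c l)) := by
  -- Shifting row and column labels by `n - 1` leaves the entries unchanged and makes the column
  -- labels natural exponents.
  let β : Fin n → ℤ := fun i => b i + (n - 1)
  let t : Fin n → ℕ := fun l => (c l + (n - 1)).toNat
  have ht : ∀ l : Fin n, (t l : ℤ) = c l + (n - 1) := fun l => Int.toNat_of_nonneg (hc l l.2)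
  have hb : jacobiTrudi n b = columnMap β (MvPolynomial.monomial
      (Finsupp.equivFunOnFinite.symm fun l : Fin n => n - 1 - (l : ℕ)) 1) := by
    rw [columnMap_monomial, jacobiTrudi]
    congr 1
    ext1 i j
    simp only [Matrix.of_apply, Finsupp.equivFunOnFinite_symm_apply_apply, β]
    congr 1
    have := j.2
    omega
  have hcc : Matrix.det (Matrix.of fun i l : Fin n => hInt (b i - c l)) =
      columnMap β (MvPolynomial.monomial (Finsupp.equivFunOnFinite.symm t) 1) := by
    rw [columnMap_monomial]
    congr 1
    ext1 i j
    simp only [Matrix.of_apply, Finsupp.equivFunOnFinite_symm_apply_apply, ht, β]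
    congr 1
    ring
  have hn : (n.factorial : ℚ) ≠ 0 := by exact_mod_cast n.factorial_ne_zero
  -- After antisymmetrization, the bialternant formula turns multiplication by the symmetric factor
  -- into passage from the staircase exponents to `t`; the factor `n!` occurs on both sides.
  have h1 := columnMap_alternant β (fun l : Fin n => n - 1 - (l : ℕ)) (jacobiTrudi n c)
  have h2 := columnMap_alternant β t 1
  rw [toVars_jacobiTrudi_mul_alternant t c ht] at h1
  rw [map_one, one_mul, one_mul, h1] at h2
  rw [hb, hcc, skew_columnMap]
  have h3 := congrArg (fun x => (n.factorial : ℚ)⁻¹ • x) h2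
  simpa only [smul_smul, inv_mul_cancel₀ hn, one_smul] using h3

/-! ### Toeplitz matrices -/

/-- `e_m` for an integer index. -/
noncomputable def eInt (m : ℤ) : Sym := omegaHom (hInt m)

theorem eInt_natCast (n : ℕ) : eInt (n : ℤ) = e n := omegaHom_h n

theorem eInt_neg {m : ℤ} (hm : m < 0) : eInt m = 0 := by rw [eInt, hInt_neg hm, map_zero]

/-- The sign `(-1)^m`. -/
noncomputable def sgn (m : ℤ) : Sym := ((m.negOnePow : ℤˣ) : ℤ)

theorem sgn_add (a b : ℤ) : sgn (a + b) = sgn a * sgn b := by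
  simp [sgn, Int.negOnePow_add]

theorem sgn_sub (a b : ℤ) : sgn (a - b) = sgn a * sgn b := by
  simp [sgn, Int.negOnePow_sub]

theorem sgn_neg (a : ℤ) : sgn (-a) = sgn a := by
  simp [sgn, Int.negOnePow_neg]

theorem sgn_mul_self (a : ℤ) : sgn a * sgn a = 1 := by
  rw [← sgn_add]; simp [sgn]

theorem sgn_zero : sgn 0 = 1 := by simp [sgn]

theorem sgn_natCast (n : ℕ) : sgn n = (-1) ^ n := by
  have : (n : ℤ).negOnePow = (-1) ^ n := by rw [Int.negOnePow_def, zpow_natCast]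
  simp [sgn, this]

/-- The entry of the inverse of the Toeplitz matrix of the `h_n`. -/
noncomputable def eSigned (m : ℤ) : Sym := sgn m * eInt m

/-- Only `z ≤ y ≤ x` contributes, so any window reaching down to `z` and up to `x` already holds the
full `h`–`e` convolution. This inverts Toeplitz matrices on finite windows. -/
theorem sum_hInt_mul_eSigned (a b x z : ℤ) (ha : a ≤ z) (hb : x ≤ b) :
    ∑ y ∈ Finset.Icc a b, hInt (x - y) * eSigned (y - z) = if x = z then 1 else 0 := by
  rcases lt_or_ge x z with hxz | hxz
  · rw [if_neg (ne_of_lt hxz)]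
    refine Finset.sum_eq_zero fun y _ => ?_
    rcases lt_or_ge x y with h1 | h1
    · rw [hInt_neg (by omega), zero_mul]
    · rw [eSigned, eInt_neg (m := y - z) (by omega), mul_zero, mul_zero]
  · obtain ⟨n, hn⟩ := Int.eq_ofNat_of_zero_le (sub_nonneg.2 hxz)
    have h1 : (if x = z then (1 : Sym) else 0) = if n = 0 then 1 else 0 := by
      congr 1
      simp only [eq_iff_iff]; omega
    rw [h1, ← sum_h_mul_e, ← Finset.sum_subset (Finset.Icc_subset_Icc ha hb)]
    · refine Finset.sum_bij' (fun y _ => ((x - y).toNat, (y - z).toNat))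
        (fun q _ => z + q.2) ?_ ?_ ?_ ?_ ?_
      · intro y hy
        rw [Finset.mem_Icc] at hy
        rw [Finset.HasAntidiagonal.mem_antidiagonal]; omega
      · intro q hq
        rw [Finset.HasAntidiagonal.mem_antidiagonal] at hq
        rw [Finset.mem_Icc]; omega
      · intro y hy
        rw [Finset.mem_Icc] at hy
        simp only; omega
      · intro q hq
        rw [Finset.HasAntidiagonal.mem_antidiagonal] at hq
        ext <;> simp only <;> omega
      · intro y hy
        rw [Finset.mem_Icc] at hy
        obtain ⟨c, hc⟩ := Int.eq_ofNat_of_zero_le (sub_nonneg.2 hy.1)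
        obtain ⟨d, hd⟩ := Int.eq_ofNat_of_zero_le (sub_nonneg.2 hy.2)
        rw [eSigned, hc, hd, sgn_natCast, eInt_natCast, hInt_natCast, Int.toNat_natCast,
          Int.toNat_natCast]
    · intro y _ hy
      rw [Finset.mem_Icc, not_and_or, not_le, not_le] at hy
      rcases hy with h1 | h1
      · rw [eSigned, eInt_neg (m := y - z) (by omega), mul_zero, mul_zero]
      · rw [hInt_neg (by omega), zero_mul]

/-- Rows of the identity matrix can be deleted from a determinant, with their columns. -/
theorem det_eq_det_submatrix {ι κ R : Type*} [Fintype ι] [DecidableEq ι] [Fintype κ]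
    [DecidableEq κ] [CommRing R] (M : Matrix ι ι R) (g : κ → ι) (hg : Function.Injective g)
    (hM : ∀ w, w ∉ Set.range g → ∀ v, M w v = if w = v then 1 else 0) :
    M.det = (M.submatrix g g).det := by
  classical
  rw [Matrix.twoBlockTriangular_det M (fun w => w ∈ Set.range g)]
  · have h1 : (M.toSquareBlockProp fun w => ¬ w ∈ Set.range g) = 1 := by
      ext1 w v
      rw [Matrix.toSquareBlockProp_def, Matrix.of_apply, hM _ w.2, Matrix.one_apply]
      simp only [Subtype.ext_iff]
    rw [h1, Matrix.det_one, mul_one]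
    let f : κ ≃ {w // w ∈ Set.range g} := Equiv.ofInjective g hg
    have h2 : M.submatrix g g =
        (M.toSquareBlockProp fun w => w ∈ Set.range g).submatrix f f := rfl
    rw [h2]
    convert (Matrix.det_submatrix_equiv_self f
      (M.toSquareBlockProp fun w => w ∈ Set.range g)).symm
  · intro w hw v hv
    rw [hM w hw, if_neg]
    rintro rfl
    exact hw hv

/-! ### The dual Jacobi–Trudi formula -/

section Dual

variable (μ : YoungDiagram) (s : ℕ)

theorem schur_eq_jacobiTrudi :
    schur μ = jacobiTrudi (μ.colLen 0) fun i => (μ.rowLen i : ℤ) - i := rfl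

/-- The positions of the vertical and horizontal steps of the boundary of `μ`. -/
def boundaryFun (w : ℕ) : ℕ :=
  if w < μ.colLen 0 then w + μ.rowLen (μ.colLen 0 - 1 - w)
  else w - μ.colLen (w - μ.colLen 0)

variable {μ s}

theorem lt_rowLen_iff_lt_colLen (i j : ℕ) : j < μ.rowLen i ↔ i < μ.colLen j := by
  rw [← YoungDiagram.mem_iff_lt_rowLen, ← YoungDiagram.mem_iff_lt_colLen]

theorem boundaryFun_lt (hs : μ.rowLen 0 ≤ s) (w : ℕ) (hw : w < μ.colLen 0 + s) :
    boundaryFun μ w < μ.colLen 0 + s := by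
  unfold boundaryFun
  split_ifs with h1
  · have := μ.rowLen_anti 0 (μ.colLen 0 - 1 - w) (Nat.zero_le _)
    omega
  · omega

/-- The order of the boundary steps. -/
theorem boundaryFun_lt_iff {v w : ℕ} (hvw : w < v) :
    (boundaryFun μ w < boundaryFun μ v ↔
      ¬ (w < μ.colLen 0 ∧ μ.colLen 0 ≤ v ∧
        μ.colLen 0 - 1 - w < μ.colLen (v - μ.colLen 0))) ∧
    boundaryFun μ w ≠ boundaryFun μ v := by
  unfold boundaryFun
  have hc : ∀ j, μ.colLen j ≤ μ.colLen 0 := fun j => μ.colLen_anti 0 j (Nat.zero_le _)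
  by_cases h1 : w < μ.colLen 0
  · by_cases h2 : v < μ.colLen 0
    · have := μ.rowLen_anti (μ.colLen 0 - 1 - v) (μ.colLen 0 - 1 - w) (by omega)
      simp only [h1, h2, if_true, true_and]
      omega
    · simp only [h1, h2, if_true, if_false, true_and]
      have h3 := lt_rowLen_iff_lt_colLen (μ := μ) (μ.colLen 0 - 1 - w) (v - μ.colLen 0)
      have := hc (v - μ.colLen 0)
      omega
  · have h2 : ¬ v < μ.colLen 0 := by omega
    have := μ.colLen_anti (w - μ.colLen 0) (v - μ.colLen 0) (by omega)
    have := hc (w - μ.colLen 0)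
    simp only [h1, h2, if_false, false_and, not_false_iff, iff_true]
    omega

/-- The permutation of the boundary steps. -/
noncomputable def boundaryPerm (hs : μ.rowLen 0 ≤ s) : Equiv.Perm (Fin (μ.colLen 0 + s)) :=
  Equiv.ofBijective (fun w => ⟨boundaryFun μ w, boundaryFun_lt hs w w.2⟩) <|
    Finite.injective_iff_bijective.1 fun v w hvw => by
      have hvw' : boundaryFun μ v = boundaryFun μ w := congrArg Fin.val hvw
      by_contra hne
      rcases lt_or_gt_of_ne (fun hc => hne (Fin.ext hc) : (v : ℕ) ≠ w) with hlt | hlt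
      · exact (boundaryFun_lt_iff hlt).2 hvw'
      · exact (boundaryFun_lt_iff hlt).2 hvw'.symm

theorem boundaryPerm_apply (hs : μ.rowLen 0 ≤ s) (w : Fin (μ.colLen 0 + s)) :
    (boundaryPerm hs w : ℕ) = boundaryFun μ w := rfl

/-- An inversion pairs a vertical step with a horizontal one and names a cell of `μ` by its row and
column; inversions are counted column by column. -/
theorem sign_boundaryPerm (hs : μ.rowLen 0 ≤ s) :
    Equiv.Perm.sign (boundaryPerm hs) = ∏ c : Fin s, (-1 : ℤˣ) ^ μ.colLen c := by
  rw [Equiv.Perm.sign_eq_prod_prod_Iio, Fin.prod_univ_add]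
  have h1 : ∀ v : Fin (μ.colLen 0), ∏ w ∈ Finset.Iio (Fin.castAdd s v),
      (if boundaryPerm hs w < boundaryPerm hs (Fin.castAdd s v) then (1 : ℤˣ) else -1) = 1 := by
    intro v
    refine Finset.prod_eq_one fun w hw => ?_
    have hw' : w < Fin.castAdd s v := Finset.mem_Iio.1 hw
    rw [if_pos]
    refine (boundaryFun_lt_iff hw').1.2 ?_
    have := v.2
    have h2 : ((Fin.castAdd s v : Fin (μ.colLen 0 + s)) : ℕ) = v := rfl
    omega
  rw [Finset.prod_congr rfl fun v _ => h1 v, Finset.prod_const_one, one_mul]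
  refine Finset.prod_congr rfl fun c _ => ?_
  rw [Finset.prod_ite, Finset.prod_const_one, one_mul, Finset.prod_const]
  congr 1
  have h2 : μ.colLen c ≤ μ.colLen 0 := μ.colLen_anti 0 c (Nat.zero_le _)
  rw [← Finset.card_range (μ.colLen c)]
  symm
  refine Finset.card_bij (fun i hi => ⟨μ.colLen 0 - 1 - i, by
    have := Finset.mem_range.1 hi; omega⟩) ?_ ?_ ?_
  · intro i hi
    have hi' := Finset.mem_range.1 hi
    have hlt : μ.colLen 0 - 1 - i < μ.colLen 0 + c := by omega
    rw [Finset.mem_filter, Finset.mem_Iio]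
    refine ⟨hlt, fun hc => ?_⟩
    refine (boundaryFun_lt_iff hlt).1.1 hc ⟨by omega, by omega, ?_⟩
    have : μ.colLen 0 + (c : ℕ) - μ.colLen 0 = c := by omega
    rw [this]; omega
  · intro i hi j hj hij
    have hi' := Finset.mem_range.1 hi
    have hj' := Finset.mem_range.1 hj
    have := congrArg Fin.val hij
    simp only at this
    omega
  · intro w hw
    rw [Finset.mem_filter, Finset.mem_Iio] at hw
    obtain ⟨hw1, hw2⟩ := hw
    have hlt : (w : ℕ) < μ.colLen 0 + c := hw1
    have h3 : ¬ boundaryFun μ w < boundaryFun μ (μ.colLen 0 + c) := hw2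
    rw [(boundaryFun_lt_iff hlt).1, not_not] at h3
    have : μ.colLen 0 + (c : ℕ) - μ.colLen 0 = c := by omega
    rw [this] at h3
    refine ⟨μ.colLen 0 - 1 - w, Finset.mem_range.2 h3.2.2, Fin.ext ?_⟩
    simp only
    omega

theorem sum_fin_eq_sum_Icc {M : Type*} [AddCommMonoid M] (n : ℕ) (f : ℤ → M) :
    ∑ y : Fin n, f (y : ℕ) = ∑ y ∈ Finset.Icc (0 : ℤ) (n - 1), f y := by
  rw [Fin.sum_univ_eq_sum_range (fun y => f (y : ℕ)) n]
  refine Finset.sum_bij' (fun y _ => (y : ℤ)) (fun y _ => y.toNat) ?_ ?_ ?_ ?_ ?_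
  · intro y hy
    have := Finset.mem_range.1 hy
    rw [Finset.mem_Icc]; omega
  · intro y hy
    rw [Finset.mem_Icc] at hy
    rw [Finset.mem_range]; omega
  · intro y _; simp
  · intro y hy
    rw [Finset.mem_Icc] at hy
    omega
  · intro y _; rfl

/-- The dual Jacobi–Trudi formula. -/
theorem schur_eq_omega_jacobiTrudi (hs : μ.rowLen 0 ≤ s) :
    schur μ = omega (jacobiTrudi s fun c => (μ.colLen c : ℤ) - c) := by
  set r := μ.colLen 0 with hr
  set π := boundaryPerm hs with hπ
  have hp1 : ∀ w : Fin (r + s), (w : ℕ) < r →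
      ((π w : ℕ) : ℤ) = w + μ.rowLen (r - 1 - w) := by
    intro w hw
    rw [hπ, boundaryPerm_apply, boundaryFun, if_pos hw]; push_cast; rfl
  have hp2 : ∀ c : Fin s, ((π (Fin.natAdd r c) : ℕ) : ℤ) = r + c - μ.colLen c := by
    intro c
    have h2 : μ.colLen c ≤ r := μ.colLen_anti 0 c (Nat.zero_le _)
    have h3 : r + (c : ℕ) - r = c := by omega
    rw [hπ, boundaryPerm_apply, boundaryFun, Fin.val_natAdd, if_neg (by omega), h3]
    omega
  -- This is Jacobi's theorem on complementary minors. Multiplying by the unimodular inverse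
  -- Toeplitz matrix `E` turns `h`-rows into unit rows and unit rows into `e`-rows, so an `r × r`
  -- minor in the `h`'s equals, up to sign, an `s × s` minor in the `e`'s.
  let M₁ : Matrix (Fin (r + s)) (Fin (r + s)) Sym := Matrix.of fun w v =>
    if (w : ℕ) < r then hInt ((π w : ℕ) - (v : ℕ)) else if w = v then 1 else 0
  let E : Matrix (Fin (r + s)) (Fin (r + s)) Sym := Matrix.of fun w v =>
    eSigned ((w : ℕ) - (v : ℕ))
  let M₂ : Matrix (Fin (r + s)) (Fin (r + s)) Sym := Matrix.of fun w v =>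
    if (w : ℕ) < r then (if π w = v then 1 else 0) else eSigned ((w : ℕ) - (v : ℕ))
  have hdetE : E.det = 1 := by
    rw [Matrix.det_of_isLowerTriangular]
    · refine Finset.prod_eq_one fun w _ => ?_
      simp [E, eSigned, sgn_zero, eInt, hInt_zero]
    · intro w v hwv
      have : (w : ℕ) < (v : ℕ) := hwv
      simp only [E, Matrix.of_apply, eSigned]
      rw [eInt_neg (by omega), mul_zero]
  have hmul : M₁ * E = M₂ := by
    ext1 w v
    rw [Matrix.mul_apply]
    simp only [M₁, E, M₂, Matrix.of_apply]
    split_ifs with hw hwv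
    · rw [sum_fin_eq_sum_Icc (r + s) fun y => hInt ((π w : ℕ) - y) * eSigned (y - (v : ℕ)),
        sum_hInt_mul_eSigned _ _ _ _ (by omega) (by have := (π w).2; push_cast; omega), if_pos]
      rw [hwv]
    · rw [sum_fin_eq_sum_Icc (r + s) fun y => hInt ((π w : ℕ) - y) * eSigned (y - (v : ℕ)),
        sum_hInt_mul_eSigned _ _ _ _ (by omega) (by have := (π w).2; push_cast; omega), if_neg]
      exact fun hc => hwv (Fin.ext (by exact_mod_cast hc))
    · simp
  have hleft : M₁.det = schur μ := by
    rw [det_eq_det_submatrix M₁ (fun i : Fin r => Fin.castAdd s (Fin.rev i))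
      ((Fin.castAdd_injective r s).comp Fin.rev_injective)]
    · rw [schur_eq_jacobiTrudi, jacobiTrudi]
      congr 1
      ext1 i j
      have hi := i.2
      have hj := j.2
      have hlt : ((Fin.castAdd s (Fin.rev i) : Fin (r + s)) : ℕ) < r := by
        rw [Fin.val_castAdd]; exact (Fin.rev i).2
      rw [Matrix.submatrix_apply]
      simp only [M₁, Matrix.of_apply]
      rw [if_pos hlt, hp1 _ hlt]
      simp only [Fin.val_castAdd, Fin.val_rev]
      have : r - 1 - (r - ((i : ℕ) + 1)) = i := by omega
      rw [this]
      congr 1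
      omega
    · intro w hw v
      simp only [M₁, Matrix.of_apply]
      rw [if_neg]
      intro hlt
      exact hw ⟨Fin.rev ⟨w, hlt⟩, by simp⟩
  have hright : (M₂.submatrix id π).det =
      (∏ c : Fin s, (-1 : Sym) ^ μ.colLen c) *
        omega (jacobiTrudi s fun c => (μ.colLen c : ℤ) - c) := by
    rw [det_eq_det_submatrix _ (fun c : Fin s => Fin.natAdd r c) (Fin.natAdd_injective _ _)]
    · have h1 : (M₂.submatrix id π).submatrix (fun c : Fin s => Fin.natAdd r c)
          (fun c : Fin s => Fin.natAdd r c) = Matrix.of fun c d : Fin s =>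
            sgn (c : ℕ) * (Matrix.of fun c d : Fin s => sgn (μ.colLen d - (d : ℕ)) *
              (Matrix.of fun c d : Fin s => eInt (μ.colLen d - (d : ℕ) + (c : ℕ))) c d) c d := by
        ext1 c d
        simp only [Matrix.submatrix_apply, id, M₂, Matrix.of_apply]
        rw [if_neg (by rw [Fin.val_natAdd]; omega), hp2, eSigned, ← mul_assoc, ← sgn_add]
        have h2 : ((Fin.natAdd r c : Fin (r + s)) : ℕ) - ((r : ℤ) + d - μ.colLen d) =
            c + (μ.colLen d - (d : ℕ)) := by rw [Fin.val_natAdd]; push_cast; ring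
        rw [h2]
        congr 2
        ring
      rw [h1, Matrix.det_mul_column, Matrix.det_mul_row, ← mul_assoc, ← Finset.prod_mul_distrib]
      congr 1
      · refine Finset.prod_congr rfl fun c _ => ?_
        rw [← sgn_add, ← sgn_natCast]
        congr 1; ring
      · rw [← Matrix.det_transpose, omega_apply, jacobiTrudi, AlgHom.map_det]
        rfl
    · intro w hw v
      rw [Matrix.submatrix_apply]
      simp only [M₂, Matrix.of_apply, id]
      rw [if_pos]
      · simp only [π.injective.eq_iff]
      · by_contra hlt
        exact hw ⟨⟨w - r, by have := w.2; omega⟩, by ext; simp; omega⟩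
  rw [Matrix.det_permute', ← hmul, Matrix.det_mul, hdetE, mul_one, hleft,
    sign_boundaryPerm] at hright
  have hcast : (((∏ c : Fin s, (-1 : ℤˣ) ^ μ.colLen c : ℤˣ) : ℤ) : Sym) =
      ∏ c : Fin s, (-1 : Sym) ^ μ.colLen c := by
    simp
  rw [hcast] at hright
  have hsq : (∏ c : Fin s, (-1 : Sym) ^ μ.colLen c) * (∏ c : Fin s, (-1 : Sym) ^ μ.colLen c) =
      1 := by
    rw [← Finset.prod_mul_distrib]
    exact Finset.prod_eq_one fun c _ => neg_one_pow_mul_self _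
  have := congrArg (fun x => (∏ c : Fin s, (-1 : Sym) ^ μ.colLen c) * x) hright
  simpa only [← mul_assoc, hsq, one_mul] using this

end Dual

/-! ### Determinants attached to a descent set -/

section Window

variable {s k : ℕ}

/-- The integer in `[-s, k]` that labels a row. -/
def pos : Fin s ⊕ Fin (k + 1) → ℤ := Sum.elim (fun i => -((i : ℕ) + 1 : ℤ)) fun j => (j : ℕ)

@[simp] theorem pos_inl (i : Fin s) :
    pos (Sum.inl i : Fin s ⊕ Fin (k + 1)) = -((i : ℕ) + 1 : ℤ) := rfl

@[simp] theorem pos_inr (j : Fin (k + 1)) :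
    pos (Sum.inr j : Fin s ⊕ Fin (k + 1)) = (j : ℕ) := rfl

theorem pos_injective : Function.Injective (pos : Fin s ⊕ Fin (k + 1) → ℤ) := by
  rintro (i | i) (j | j) hij
  · simp only [pos_inl] at hij
    exact congrArg _ (Fin.ext (by omega))
  · simp only [pos_inl, pos_inr] at hij; omega
  · simp only [pos_inl, pos_inr] at hij; omega
  · simp only [pos_inr] at hij
    exact congrArg _ (Fin.ext (by omega))

theorem pos_mem (w : Fin s ⊕ Fin (k + 1)) : pos w ∈ Finset.Icc (-(s : ℤ)) k := by
  rcases w with i | j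
  · have := i.2
    rw [pos_inl, Finset.mem_Icc]; omega
  · have := j.2
    rw [pos_inr, Finset.mem_Icc]; omega

theorem exists_pos_eq {x : ℤ} (hx : x ∈ Finset.Icc (-(s : ℤ)) k) :
    ∃ w : Fin s ⊕ Fin (k + 1), pos w = x := by
  rw [Finset.mem_Icc] at hx
  rcases lt_or_ge x 0 with h0 | h0
  · exact ⟨Sum.inl ⟨(-x - 1).toNat, by omega⟩, by simp only [pos_inl]; omega⟩
  · exact ⟨Sum.inr ⟨x.toNat, by omega⟩, by simp only [pos_inr]; omega⟩

theorem sum_pos {M : Type*} [AddCommMonoid M] (F : ℤ → M) :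
    ∑ w : Fin s ⊕ Fin (k + 1), F (pos w) = ∑ y ∈ Finset.Icc (-(s : ℤ)) k, F y := by
  refine Finset.sum_nbij pos (fun w _ => pos_mem w) pos_injective.injOn ?_ fun _ _ => rfl
  intro x hx
  obtain ⟨w, hw⟩ := exists_pos_eq (Finset.mem_coe.1 hx)
  exact ⟨w, Finset.mem_coe.2 (Finset.mem_univ _), hw⟩

theorem det_of_triangular {ι R : Type*} [Fintype ι] [DecidableEq ι] [CommRing R] (q : ι → ℤ)
    (hq : Function.Injective q) (M : Matrix ι ι R) (hM : ∀ i j, q i < q j → M i j = 0) :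
    M.det = ∏ i, M i i := by
  let _ : LinearOrder ι := LinearOrder.lift' q hq
  exact Matrix.det_of_isLowerTriangular M fun i j hij => hM i j hij

variable (s k) in
/-- The Toeplitz matrix with entries `T_{x - y}`. -/
noncomputable def toeplitz (T : ℤ → Sym) : Matrix (Fin s ⊕ Fin (k + 1)) (Fin s ⊕ Fin (k + 1)) Sym :=
  Matrix.of fun w v => T (pos w - pos v)

theorem det_toeplitz_hInt : (toeplitz s k hInt).det = 1 := by
  rw [det_of_triangular pos pos_injective]
  · exact Finset.prod_eq_one fun w _ => by simp [toeplitz, hInt_zero]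
  · intro i j hij
    exact hInt_neg (by omega)

theorem toeplitz_eSigned_mul : toeplitz s k eSigned * toeplitz s k hInt = 1 := by
  rw [mul_eq_one_comm]
  ext1 w v
  have hw := Finset.mem_Icc.1 (pos_mem w)
  have hv := Finset.mem_Icc.1 (pos_mem v)
  rw [Matrix.mul_apply]
  simp only [toeplitz, Matrix.of_apply]
  rw [sum_pos fun y => hInt (pos w - y) * eSigned (y - pos v),
    sum_hInt_mul_eSigned _ _ _ _ hv.1 hw.2, Matrix.one_apply]
  simp only [pos_injective.eq_iff]

/-- The rows of `ribbonDet` with nonnegative label: `T_k` in row `0`, a unit vector in row `k`,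
and in between `T_j` if `j ∈ D` and a unit vector otherwise. -/
noncomputable def ribbonRow (T : ℤ → Sym) (D : Finset ℕ) (j : Fin (k + 1)) (v : Fin s ⊕ Fin (k + 1)) : Sym :=
  if (j : ℕ) = k then (if Sum.inr j = v then 1 else 0)
  else if (j : ℕ) = 0 then T (k - pos v)
  else if (j : ℕ) ∈ D then T ((j : ℕ) - pos v)
  else if Sum.inr j = v then 1 else 0

/-- The determinant that describes the action of a ribbon operator. -/
noncomputable def ribbonDet (T : ℤ → Sym) (k : ℕ) (D : Finset ℕ) (f : Fin s → ℤ) : Sym :=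
  Matrix.det (Matrix.of (Sum.elim (fun i v => T (f i - pos v)) (ribbonRow (k := k) T D)))

theorem omegaHom_ribbonDet (D : Finset ℕ) (f : Fin s → ℤ) :
    omegaHom (ribbonDet hInt k D f) = ribbonDet eInt k D f := by
  rw [ribbonDet, AlgHom.map_det, ribbonDet]
  congr 1
  ext1 w v
  rcases w with i | j
  · rfl
  · simp only [AlgHom.mapMatrix_apply, Matrix.map_apply, Matrix.of_apply, Sum.elim_inr, ribbonRow]
    split_ifs <;> simp [eInt]

/-- A determinant with rows `k = d_0 > d_1 > ⋯ > d_r`, followed by `f`, and columns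
`d_1, …, d_r, 0, -1, …, -s`. -/
theorem det_eq_ribbonDet (r : ℕ) (d : ℕ → ℕ) (hd0 : d 0 = k)
    (hd : ∀ i j, i < j → j ≤ r → d j < d i) (hpos : ∀ i, i ≤ r → 0 < d i) (f : ℕ → ℤ) :
    Matrix.det (Matrix.of fun i l : Fin (s + (r + 1)) => hInt
      ((if (i : ℕ) < r + 1 then (d i : ℤ) else f (i - (r + 1))) -
        (if (l : ℕ) < r then (d (l + 1) : ℤ) else -((l : ℤ) - r)))) =
      (-1) ^ r * ribbonDet (s := s) hInt k ((Finset.range r).image fun i => d (i + 1))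
        (fun i => f i) := by
  have hdk : ∀ i, i ≤ r → d i ≤ k := by
    intro i hi
    rcases Nat.eq_zero_or_pos i with rfl | h0
    · exact hd0.le
    · exact hd0 ▸ (hd 0 i h0 hi).le
  let Y : Fin (s + (r + 1)) → ℤ := fun l =>
    if (l : ℕ) < r then (d (l + 1) : ℤ) else -((l : ℤ) - r)
  let g : Fin (s + (r + 1)) → Fin s ⊕ Fin (k + 1) := fun l =>
    if h1 : (l : ℕ) < r then Sum.inr ⟨d (l + 1), by have := hdk (l + 1) (by omega); omega⟩
    else if h2 : (l : ℕ) = r then Sum.inr 0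
    else Sum.inl ⟨l - (r + 1), by omega⟩
  have hgY : ∀ l, pos (g l) = Y l := by
    intro l
    by_cases h1 : (l : ℕ) < r
    · simp only [g, Y, h1, dif_pos, if_true, pos_inr]
    · by_cases h2 : (l : ℕ) = r
      · simp only [g, Y, h2, lt_irrefl, dif_neg, not_false_iff, dif_pos, if_false, pos_inr]
        simp
      · simp only [g, Y, h1, h2, dif_neg, not_false_iff, if_false, pos_inl]
        omega
  have hY : Function.Injective Y := by
    intro l l' hll
    simp only [Y] at hll
    by_contra hne
    have hne' : (l : ℕ) ≠ l' := fun h => hne (Fin.ext h)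
    split_ifs at hll with h1 h2 h2
    · rcases lt_or_gt_of_ne hne' with h3 | h3
      · have := hd (l + 1) (l' + 1) (by omega) (by omega); omega
      · have := hd (l' + 1) (l + 1) (by omega) (by omega); omega
    · have := hpos (l + 1) (by omega); omega
    · have := hpos (l' + 1) (by omega); omega
    · omega
  have hg : Function.Injective g := fun l l' hll => hY (by rw [← hgY, ← hgY, hll])
  rw [ribbonDet, det_eq_det_submatrix _ g hg]
  · have hr : r < s + (r + 1) := by omega
    -- The cycle moves the row of label `k` from the top to place `r`, opposite the column of label
    -- `0`. The rows `d_1, …, d_r` then face their own columns, at the cost of the sign `(-1)^r`.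
    have h1 := Matrix.det_permute (Fin.cycleRange (⟨r, hr⟩ : Fin (s + (r + 1))))
      (Matrix.of fun i l : Fin (s + (r + 1)) => hInt
        ((if (i : ℕ) < r + 1 then (d i : ℤ) else f (i - (r + 1))) -
          (if (l : ℕ) < r then (d (l + 1) : ℤ) else -((l : ℤ) - r))))
    rw [Fin.sign_cycleRange] at h1
    have h2 : (Matrix.submatrix (Matrix.of (Sum.elim (fun i v => hInt (f (i : Fin s) - pos v))
        (ribbonRow (k := k) hInt ((Finset.range r).image fun i => d (i + 1))))) g g) =
        (Matrix.of fun i l : Fin (s + (r + 1)) => hInt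
          ((if (i : ℕ) < r + 1 then (d i : ℤ) else f (i - (r + 1))) -
            (if (l : ℕ) < r then (d (l + 1) : ℤ) else -((l : ℤ) - r)))).submatrix
          (Fin.cycleRange (⟨r, hr⟩ : Fin (s + (r + 1)))) id := by
      ext1 l v
      simp only [Matrix.submatrix_apply, Matrix.of_apply, id]
      change _ = hInt (_ - Y v)
      rw [← hgY]
      rcases lt_trichotomy (l : ℕ) r with h3 | h3 | h3
      · have h4 : ((Fin.cycleRange (⟨r, hr⟩ : Fin (s + (r + 1))) l : Fin (s + (r + 1))) : ℕ) =
            l + 1 := Fin.coe_cycleRange_of_lt h3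
        have h5 : g l = Sum.inr ⟨d (l + 1), by have := hdk (l + 1) (by omega); omega⟩ := by
          simp only [g, h3, dif_pos]
        have h6 := hd 0 (l + 1) (by omega) (by omega)
        have h7 := hpos (l + 1) (by omega)
        rw [h4, h5, if_pos (by omega)]
        simp only [Sum.elim_inr, ribbonRow]
        rw [if_neg (by omega), if_neg (by omega), if_pos]
        exact Finset.mem_image.2 ⟨l, Finset.mem_range.2 h3, rfl⟩
      · have hl : l = ⟨r, hr⟩ := Fin.ext h3
        have h4 : ((Fin.cycleRange (⟨r, hr⟩ : Fin (s + (r + 1))) l : Fin (s + (r + 1))) : ℕ) =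
            0 := by
          rw [hl, Fin.cycleRange_of_eq rfl]; rfl
        have h5 : g l = Sum.inr 0 := by
          simp only [g, h3, lt_irrefl, dif_neg, not_false_iff, dif_pos]
        have h6 := hpos 0 (by omega)
        rw [h4, h5, if_pos (by omega), hd0]
        simp only [Sum.elim_inr, ribbonRow]
        rw [if_neg (by simp; omega), if_pos (by simp)]
      · have h4 : Fin.cycleRange (⟨r, hr⟩ : Fin (s + (r + 1))) l = l :=
          Fin.cycleRange_of_gt h3
        have h5 : g l = Sum.inl ⟨l - (r + 1), by omega⟩ := by
          have h6 : ¬ (l : ℕ) < r := by omega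
          have h7 : ¬ (l : ℕ) = r := by omega
          simp only [g, h6, h7, dif_neg, not_false_iff]
        rw [h4, h5, if_neg (by omega)]
        rfl
    rw [h2, h1]
    simp only [Units.val_pow_eq_pow_val, Units.val_neg, Units.val_one, Int.cast_pow, Int.cast_neg,
      Int.cast_one]
    rw [← mul_assoc, neg_one_pow_mul_self, one_mul]
  · intro w hw v
    have hinl : ∀ i : Fin s, w ≠ Sum.inl i := by
      rintro i rfl
      refine hw ⟨⟨i + (r + 1), by omega⟩, ?_⟩
      refine pos_injective ?_
      rw [hgY]
      simp only [Y, pos_inl]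
      rw [if_neg (by omega)]
      push_cast; ring
    rcases w with i | j
    · exact absurd rfl (hinl i)
    · simp only [Matrix.of_apply, Sum.elim_inr, ribbonRow]
      split_ifs with h1 h2 h3 h4 h5 h6 <;> try rfl
      · exfalso
        refine hw ⟨⟨r, by omega⟩, pos_injective ?_⟩
        rw [hgY]
        simp [Y, h3]
      · exfalso
        refine hw ⟨⟨r, by omega⟩, pos_injective ?_⟩
        rw [hgY]
        simp [Y, h3]
      all_goals
        exfalso
        obtain ⟨i, hi, hij⟩ := Finset.mem_image.1 ‹_›
        have hi' := Finset.mem_range.1 hi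
        refine hw ⟨⟨i, by omega⟩, pos_injective ?_⟩
        rw [hgY]
        simp only [Y, pos_inr]
        rw [if_pos hi', hij]

end Window

/-! ### The determinant identity behind the hat involution -/

section Complement

variable {s k : ℕ}

theorem ribbonRow_zero (hk : 1 ≤ k) (T : ℤ → Sym) (D : Finset ℕ) (v : Fin s ⊕ Fin (k + 1)) :
    ribbonRow T D 0 v = T (k - pos v) := by
  have h1 : ((0 : Fin (k + 1)) : ℕ) = 0 := rfl
  rw [ribbonRow, if_neg (by omega), if_pos h1]

theorem ribbonRow_mem (T : ℤ → Sym) {D : Finset ℕ} {j : Fin (k + 1)} (hk : (j : ℕ) ≠ k)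
    (h0 : (j : ℕ) ≠ 0) (hD : (j : ℕ) ∈ D) (v : Fin s ⊕ Fin (k + 1)) :
    ribbonRow T D j v = T (pos (Sum.inr j : Fin s ⊕ Fin (k + 1)) - pos v) := by
  rw [ribbonRow, if_neg hk, if_neg h0, if_pos hD, pos_inr]

theorem ribbonRow_unit (T : ℤ → Sym) {D : Finset ℕ} {j : Fin (k + 1)}
    (h0 : (j : ℕ) ≠ 0) (hD : (j : ℕ) = k ∨ (j : ℕ) ∉ D) (v : Fin s ⊕ Fin (k + 1)) :
    ribbonRow T D j v = if Sum.inr j = v then 1 else 0 := by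
  rw [ribbonRow]
  by_cases hk : (j : ℕ) = k
  · rw [if_pos hk]
  · rw [if_neg hk, if_neg h0, if_neg (hD.resolve_left hk)]

variable (s k) in
/-- The matrix of `ribbonDet` with the rows of negative label replaced by unit vectors. -/
noncomputable def unitRowsMatrix (T : ℤ → Sym) (D : Finset ℕ) (x : Fin s → ℤ) :
    Matrix (Fin s ⊕ Fin (k + 1)) (Fin s ⊕ Fin (k + 1)) Sym :=
  Matrix.of (Sum.elim (fun i v => if x i = pos v then 1 else 0) (ribbonRow T D))

theorem sgn_pos_mul_ribbonRow (hk : 1 ≤ k) (D : Finset ℕ) (j : Fin (k + 1))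
    (v : Fin s ⊕ Fin (k + 1)) :
    sgn (pos v) * ribbonRow eInt D j v =
      sgn (j : ℕ) * (if j = 0 then sgn k else 1) * ribbonRow eSigned D j v := by
  by_cases h0 : (j : ℕ) = 0
  · obtain rfl : j = 0 := Fin.ext h0
    rw [ribbonRow_zero hk, ribbonRow_zero hk, if_pos rfl, h0, Nat.cast_zero, sgn_zero, eSigned,
      sgn_sub]
    linear_combination (-sgn (pos v) * eInt (k - pos v)) * sgn_mul_self k
  · rw [if_neg (fun hc => h0 (by rw [hc]; rfl)), mul_one]
    by_cases hD : (j : ℕ) = k ∨ (j : ℕ) ∉ D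
    · rw [ribbonRow_unit _ h0 hD, ribbonRow_unit _ h0 hD]
      split_ifs with h1
      · rw [← h1, pos_inr]
      · rw [mul_zero, mul_zero]
    · rw [not_or, not_not] at hD
      rw [ribbonRow_mem _ hD.1 h0 hD.2, ribbonRow_mem _ hD.1 h0 hD.2, eSigned, sgn_sub, pos_inr]
      linear_combination
        (-sgn (pos v) * eInt ((j : ℕ) - pos v)) * sgn_mul_self ((j : ℕ) : ℤ)

/-- Conjugation by the diagonal matrix of signs `(-1)^pos` turns `e` into signed `e`. Row and column
factors cancel, except that the row at position `0` really has label `k`, which leaves `sgn k`. -/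
theorem det_signed_unit_rows (hk : 1 ≤ k) (D : Finset ℕ) (x : Fin s → ℤ) :
    Matrix.det (Matrix.of (Sum.elim
      (fun (i : Fin s) v => sgn (x i + (i + 1 : ℤ)) * if x i = pos v then 1 else 0)
      (ribbonRow (s := s) (k := k) eInt D))) =
      sgn k * (unitRowsMatrix s k eSigned D x).det := by
  set M₁ : Matrix (Fin s ⊕ Fin (k + 1)) (Fin s ⊕ Fin (k + 1)) Sym := Matrix.of (Sum.elim
      (fun (i : Fin s) v => sgn (x i + (i + 1 : ℤ)) * if x i = pos v then 1 else 0)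
      (ribbonRow (s := s) (k := k) eInt D)) with hM₁
  have hscale : (∏ v : Fin s ⊕ Fin (k + 1), sgn (pos v)) * M₁.det =
      (∏ v : Fin s ⊕ Fin (k + 1), sgn (pos v)) *
        (sgn k * (unitRowsMatrix s k eSigned D x).det) := by
    rw [← Matrix.det_mul_row]
    have h1 : (Matrix.of fun w v => sgn (pos v) * M₁ w v) = Matrix.of fun w v =>
        (sgn (pos w) * if w = Sum.inr 0 then sgn k else 1) *
          unitRowsMatrix s k eSigned D x w v := by
      ext1 w v
      rw [Matrix.of_apply, Matrix.of_apply]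
      rcases w with i | j
      · simp only [hM₁, unitRowsMatrix, Matrix.of_apply, Sum.elim_inl, reduceCtorEq, if_false,
          mul_one, pos_inl]
        split_ifs with h2
        · rw [← h2, sgn_add, sgn_neg, mul_one, mul_one, ← mul_assoc, sgn_mul_self, one_mul]
        · rw [mul_zero, mul_zero, mul_zero]
      · simp only [hM₁, unitRowsMatrix, Matrix.of_apply, Sum.elim_inr, pos_inr, Sum.inr.injEq]
        exact sgn_pos_mul_ribbonRow hk D j v
    rw [h1, Matrix.det_mul_column, Finset.prod_mul_distrib, Finset.prod_ite_eq' Finset.univ,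
      if_pos (Finset.mem_univ _), mul_assoc]
  have h1 : (∏ v : Fin s ⊕ Fin (k + 1), sgn (pos v)) *
      (∏ v : Fin s ⊕ Fin (k + 1), sgn (pos v)) = 1 := by
    rw [← Finset.prod_mul_distrib]
    exact Finset.prod_eq_one fun v _ => sgn_mul_self _
  have h2 := congrArg (fun y => (∏ v : Fin s ⊕ Fin (k + 1), sgn (pos v)) * y) hscale
  simpa only [← mul_assoc, h1, one_mul] using h2

theorem sum_eSigned_mul_toeplitz (w v : Fin s ⊕ Fin (k + 1)) :
    ∑ y, eSigned (pos w - pos y) * toeplitz s k hInt y v = if w = v then 1 else 0 := by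
  have := congrFun (congrFun (toeplitz_eSigned_mul (s := s) (k := k)) w) v
  rw [Matrix.mul_apply, Matrix.one_apply] at this
  exact this

theorem sum_unit_mul_toeplitz (w v : Fin s ⊕ Fin (k + 1)) :
    ∑ y, (if w = y then (1 : Sym) else 0) * toeplitz s k hInt y v = hInt (pos w - pos v) := by
  simp [toeplitz]

/-- The Toeplitz matrix of the `h`'s inverts that of the signed `e`'s, so `e`-rows become unit rows
and unit rows become `h`-rows; membership in `D` flips. The row at `0`, of label `k`, becomes the
unit row at `k`, and the unit row at `k` becomes the `h`-row of label `k`, whence the transposition.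
-/
theorem sum_ribbonRow_mul_toeplitz (hk : 1 ≤ k) (D : Finset ℕ) (j : Fin (k + 1))
    (v : Fin s ⊕ Fin (k + 1)) :
    ∑ y, ribbonRow eSigned D j y * toeplitz s k hInt y v =
      ribbonRow hInt (Finset.Icc 1 (k - 1) \ D) (Equiv.swap 0 (Fin.last k) j) v := by
  have hl : ((Fin.last k : Fin (k + 1)) : ℕ) = k := rfl
  have hz : ((0 : Fin (k + 1)) : ℕ) = 0 := rfl
  by_cases h0 : j = 0
  · subst h0
    rw [Equiv.swap_apply_left, ribbonRow_unit _ (by omega) (Or.inl hl),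
      ← sum_eSigned_mul_toeplitz]
    exact Finset.sum_congr rfl fun y _ => by rw [ribbonRow_zero hk, pos_inr, hl]
  · have h0' : (j : ℕ) ≠ 0 := fun hc => h0 (Fin.ext hc)
    by_cases h1 : j = Fin.last k
    · subst h1
      rw [Equiv.swap_apply_right, ribbonRow_zero hk]
      have := sum_unit_mul_toeplitz (Sum.inr (Fin.last k)) v
      rw [pos_inr, hl] at this
      rw [← this]
      exact Finset.sum_congr rfl fun y _ => by rw [ribbonRow_unit _ h0' (Or.inl hl)]
    · have h1' : (j : ℕ) ≠ k := fun hc => h1 (Fin.ext hc)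
      have hj := j.2
      have hmem : (j : ℕ) ∈ Finset.Icc 1 (k - 1) := Finset.mem_Icc.2 (by omega)
      rw [Equiv.swap_apply_of_ne_of_ne h0 h1]
      by_cases hD : (j : ℕ) ∈ D
      · rw [ribbonRow_unit _ h0' (Or.inr fun hc => (Finset.mem_sdiff.1 hc).2 hD),
          ← sum_eSigned_mul_toeplitz]
        exact Finset.sum_congr rfl fun y _ => by rw [ribbonRow_mem _ h1' h0' hD]
      · rw [ribbonRow_mem _ h1' h0' (Finset.mem_sdiff.2 ⟨hmem, hD⟩), ← sum_unit_mul_toeplitz]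
        exact Finset.sum_congr rfl fun y _ => by rw [ribbonRow_unit _ h0' (Or.inr hD)]

/-- The Toeplitz factor has determinant one, and the minus sign is that of the transposition of `0`
and `k`. The window condition makes each free row a genuine unit vector; a label outside would give
a zero row. -/
theorem det_unitRowsMatrix (hk : 1 ≤ k) (D : Finset ℕ) (x : Fin s → ℤ)
    (hx : ∀ i, x i ∈ Finset.Icc (-(s : ℤ)) k) :
    (unitRowsMatrix s k eSigned D x).det =
      -ribbonDet hInt k (Finset.Icc 1 (k - 1) \ D) x := by
  choose u hu using fun i => exists_pos_eq (hx i)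
  have hmul : unitRowsMatrix s k eSigned D x * toeplitz s k hInt =
      (Matrix.of (Sum.elim (fun i v => hInt (x i - pos v))
        (ribbonRow (k := k) hInt (Finset.Icc 1 (k - 1) \ D)))).submatrix
        (Equiv.sumCongr (Equiv.refl _) (Equiv.swap 0 (Fin.last k))) id := by
    ext1 w v
    rw [Matrix.mul_apply, Matrix.submatrix_apply, id]
    rcases w with i | j
    · simp only [unitRowsMatrix, Matrix.of_apply, Sum.elim_inl, Equiv.sumCongr_apply, Sum.map_inl,
        Equiv.refl_apply]
      rw [← hu i, ← sum_unit_mul_toeplitz]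
      exact Finset.sum_congr rfl fun y _ => by simp only [pos_injective.eq_iff]
    · exact sum_ribbonRow_mul_toeplitz hk D j v
  have h1 := congrArg Matrix.det hmul
  have h2 : (0 : Fin (k + 1)) ≠ Fin.last k := fun hc => by
    have := congrArg Fin.val hc
    simp at this; omega
  rw [Matrix.det_mul, det_toeplitz_hInt, mul_one] at h1
  have h3 : Equiv.Perm.sign (Equiv.sumCongr (Equiv.refl (Fin s))
      (Equiv.swap (0 : Fin (k + 1)) (Fin.last k))) = -1 := by
    have := Equiv.Perm.sign_sumCongr (1 : Equiv.Perm (Fin s)) (Equiv.swap 0 (Fin.last k))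
    rw [Equiv.Perm.sign_swap h2, Equiv.Perm.sign_one, one_mul] at this
    exact this
  have h4 := Matrix.det_permute (Equiv.sumCongr (Equiv.refl (Fin s))
    (Equiv.swap (0 : Fin (k + 1)) (Fin.last k)))
    (Matrix.of (Sum.elim (fun i v => hInt (x i - pos v))
      (ribbonRow (s := s) (k := k) hInt (Finset.Icc 1 (k - 1) \ D))))
  rw [h1]
  refine h4.trans ?_
  rw [h3, ribbonDet]
  simp

theorem det_unit_rows (hk : 1 ≤ k) (D : Finset ℕ) (x : Fin s → ℤ)
    (hx : ∀ i, x i ∈ Finset.Icc (-(s : ℤ)) k) :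
    Matrix.det (Matrix.of (Sum.elim
      (fun (i : Fin s) v => sgn (x i + (i + 1 : ℤ)) * if x i = pos v then 1 else 0)
      (ribbonRow (s := s) (k := k) eInt D))) =
      -sgn k * ribbonDet hInt k (Finset.Icc 1 (k - 1) \ D) x := by
  rw [det_signed_unit_rows hk, det_unitRowsMatrix hk D x hx]
  ring

end Complement

/-! ### The hat of an operator with determinantal action -/

theorem hat_apply (V : Sym →ₗ[ℚ] Sym) (f : Sym) :
    hat V f = LinearMap.mul' ℚ Sym (LinearMap.lTensor Sym V (substDiff f)) := rfl

theorem map_sgn_mul (V : Sym →ₗ[ℚ] Sym) (m : ℤ) (f : Sym) : V (sgn m * f) = sgn m * V f := by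
  rcases Int.units_eq_one_or m.negOnePow with h1 | h1 <;> simp [sgn, h1]

theorem map_prod_sgn_mul {ι : Type*} (V : Sym →ₗ[ℚ] Sym) (t : Finset ι) (m : ι → ℤ) (f : Sym) :
    V ((∏ i ∈ t, sgn (m i)) * f) = (∏ i ∈ t, sgn (m i)) * V f := by
  classical
  induction t using Finset.induction_on with
  | empty => simp
  | insert a t ha ih => rw [Finset.prod_insert ha, mul_assoc, mul_assoc, map_sgn_mul, ih]

/-- The value of `substDiff` on `h_m`, with the summation range extended. -/
theorem substDiff_hInt (a b m c : ℤ) (ha : a ≤ -c) (hb : m - c ≤ b) :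
    substDiff (hInt m) =
      ∑ y ∈ Finset.Icc a b, hInt (m - c - y) ⊗ₜ[ℚ] eSigned (y + c) := by
  rcases lt_or_ge m 0 with hm | hm
  · rw [hInt_neg hm, map_zero]
    symm
    refine Finset.sum_eq_zero fun y _ => ?_
    rcases lt_or_ge (m - c) y with h1 | h1
    · rw [hInt_neg (by omega), TensorProduct.zero_tmul]
    · rw [eSigned, eInt_neg (m := y + c) (by omega), mul_zero, TensorProduct.tmul_zero]
  · obtain ⟨n, rfl⟩ := Int.eq_ofNat_of_zero_le hm
    rw [hInt_natCast, substDiff_h, ← Finset.sum_subset (Finset.Icc_subset_Icc ha hb)]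
    · symm
      refine Finset.sum_bij' (fun y _ => ((n - c - y).toNat, (y + c).toNat))
        (fun q _ => q.2 - c) ?_ ?_ ?_ ?_ ?_
      · intro y hy
        rw [Finset.mem_Icc] at hy
        rw [Finset.HasAntidiagonal.mem_antidiagonal]; omega
      · intro q hq
        rw [Finset.HasAntidiagonal.mem_antidiagonal] at hq
        rw [Finset.mem_Icc]; omega
      · intro y hy
        rw [Finset.mem_Icc] at hy
        simp only; omega
      · intro q hq
        rw [Finset.HasAntidiagonal.mem_antidiagonal] at hq
        ext <;> simp only <;> omega
      · intro y hy
        rw [Finset.mem_Icc] at hy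
        obtain ⟨d, hd⟩ := Int.eq_ofNat_of_zero_le (show 0 ≤ n - c - y by omega)
        obtain ⟨d', hd'⟩ := Int.eq_ofNat_of_zero_le (show 0 ≤ y + c by omega)
        rw [eSigned, hd, hd', sgn_natCast, eInt_natCast, hInt_natCast, Int.toNat_natCast,
          Int.toNat_natCast]
    · intro y _ hy
      rw [Finset.mem_Icc, not_and_or, not_le, not_le] at hy
      rcases hy with h1 | h1
      · rw [eSigned, eInt_neg (m := y + c) (by omega), mul_zero, TensorProduct.tmul_zero]
      · rw [hInt_neg (by omega), TensorProduct.zero_tmul]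

/-- Extension by zero of a finite sequence. -/
def extendSeq {s : ℕ} (f : Fin s → ℤ) (i : ℕ) : ℤ := if hi : i < s then f ⟨i, hi⟩ else 0

theorem extendSeq_val {s : ℕ} (f : Fin s → ℤ) (i : Fin s) : extendSeq f i = f i := by
  rw [extendSeq, dif_pos i.2]

/-- Each entry is expanded as a convolution, with the label `y` chosen independently of the column,
so multilinearity in the rows applies. Row signs `(-1)^y` and column signs `(-1)^(j+1)` then factor
out. -/
theorem substDiff_jacobiTrudi {s k : ℕ} (x : ℕ → ℤ) (hx : ∀ i < s, x i ≤ k) :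
    substDiff (jacobiTrudi s fun i => x i + 1) =
      ∑ f : Fin s → Fin s ⊕ Fin (k + 1),
        (∏ i : Fin s, hInt (x i - pos (f i))) ⊗ₜ[ℚ]
          ((∏ i : Fin s, sgn (pos (f i) + (i + 1))) *
            omega (jacobiTrudi s fun i => extendSeq (fun i => pos (f i)) i + 1)) := by
  rw [jacobiTrudi, AlgHom.map_det]
  have h1 : substDiff.mapMatrix (Matrix.of fun i j : Fin s => hInt (x i + 1 + (j : ℕ))) =
      Matrix.of fun (i : Fin s) => ∑ y : Fin s ⊕ Fin (k + 1), fun j : Fin s =>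
        (hInt (x i - pos y) ⊗ₜ[ℚ] eSigned (pos y + (1 + (j : ℕ))) : Sym ⊗[ℚ] Sym) := by
    ext1 i j
    have hxi := hx i i.2
    have hj := j.2
    simp only [AlgHom.mapMatrix_apply, Matrix.map_apply, Matrix.of_apply, Finset.sum_apply]
    -- The window suffices: the `e`-factor vanishes for `y < -1 - j`, where `-1 - j ≥ -s`, and the
    -- `h`-factor vanishes for `y > x i`, where `x i ≤ k`.
    rw [sum_pos fun y => (hInt (x i - y) ⊗ₜ[ℚ] eSigned (y + (1 + (j : ℕ))) : Sym ⊗[ℚ] Sym),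
      substDiff_hInt (-(s : ℤ)) k _ (1 + (j : ℕ)) (by omega) (by omega)]
    refine Finset.sum_congr rfl fun y _ => ?_
    congr 2; ring
  rw [h1]
  change Matrix.detRowAlternating.toMultilinearMap (fun i => ∑ y : Fin s ⊕ Fin (k + 1),
    fun j : Fin s =>
      (hInt (x i - pos y) ⊗ₜ[ℚ] eSigned (pos y + (1 + (j : ℕ))) : Sym ⊗[ℚ] Sym)) = _
  rw [MultilinearMap.map_sum]
  refine Finset.sum_congr rfl fun f _ => ?_
  change Matrix.det (Matrix.of fun i j : Fin s =>
    (hInt (x i - pos (f i)) ⊗ₜ[ℚ] eSigned (pos (f i) + (1 + (j : ℕ))) : Sym ⊗[ℚ] Sym)) = _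
  have h2 : (Matrix.of fun i j : Fin s =>
      (hInt (x i - pos (f i)) ⊗ₜ[ℚ] eSigned (pos (f i) + (1 + (j : ℕ))) : Sym ⊗[ℚ] Sym)) =
      Matrix.of fun (i j : Fin s) => (Algebra.TensorProduct.includeLeft : Sym →ₐ[ℚ] Sym ⊗[ℚ] Sym)
        (hInt (x i - pos (f i))) *
        (Algebra.TensorProduct.includeRight : Sym →ₐ[ℚ] Sym ⊗[ℚ] Sym).mapMatrix
          (Matrix.of fun i j : Fin s => eSigned (pos (f i) + (1 + (j : ℕ)))) i j := by
    ext1 i j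
    simp
  rw [h2, Matrix.det_mul_column, ← map_prod, ← AlgHom.map_det,
    Algebra.TensorProduct.includeLeft_apply, Algebra.TensorProduct.includeRight_apply,
    Algebra.TensorProduct.tmul_mul_tmul, mul_one, one_mul]
  congr 1
  have h3 : (Matrix.of fun i j : Fin s => eSigned (pos (f i) + (1 + (j : ℕ)))) =
      Matrix.of fun i j : Fin s => sgn (pos (f i)) * (Matrix.of fun i j : Fin s =>
        sgn ((j : ℕ) + 1) * (Matrix.of fun i j : Fin s =>
          eInt (pos (f i) + 1 + (j : ℕ))) i j) i j := by
    ext1 i j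
    simp only [Matrix.of_apply, eSigned]
    rw [sgn_add, mul_assoc, add_comm (1 : ℤ), ← add_assoc, add_right_comm]
  rw [h3, Matrix.det_mul_column, Matrix.det_mul_row, ← mul_assoc, ← Finset.prod_mul_distrib]
  congr 1
  · exact Finset.prod_congr rfl fun i _ => by rw [← sgn_add]
  · rw [omega_apply, jacobiTrudi, AlgHom.map_det]
    congr 1
    ext1 i j
    simp only [AlgHom.mapMatrix_apply, Matrix.map_apply, Matrix.of_apply, extendSeq_val]
    rfl

/-- The hat of an operator that acts by `ribbonDet` acts by the `ribbonDet` of the complement. -/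
theorem hat_jacobiTrudi {s k r : ℕ} (hk : 1 ≤ k) (D : Finset ℕ) (V : Sym →ₗ[ℚ] Sym)
    (hV : ∀ f : ℕ → ℤ, V (omega (jacobiTrudi s fun i => f i + 1)) =
      omega ((-1) ^ r * ribbonDet (s := s) hInt k D fun i => f i))
    (x : ℕ → ℤ) (hx : ∀ i < s, x i ∈ Finset.Icc (-(s : ℤ)) k) :
    hat V (jacobiTrudi s fun i => x i + 1) =
      (-1) ^ (r + k + 1) *
        ribbonDet (s := s) hInt k (Finset.Icc 1 (k - 1) \ D) fun i => x i := by
  rw [hat_apply, substDiff_jacobiTrudi (k := k) x fun i hi => (Finset.mem_Icc.1 (hx i hi)).2,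
    map_sum, map_sum]
  -- Viewing the determinant as multilinear in the free rows alone lets the sum over all label
  -- choices be absorbed back into those rows.
  let Λ := MultilinearMap.currySum (Matrix.detRowAlternating (R := Sym)
    (n := Fin s ⊕ Fin (k + 1))).toMultilinearMap
  have hΛ : ∀ (G : Fin s → (Fin s ⊕ Fin (k + 1)) → Sym) A,
      Λ G A = Matrix.det (Matrix.of (Sum.elim G A)) := fun _ _ => rfl
  have h1 : ∀ f : Fin s → Fin s ⊕ Fin (k + 1),
      LinearMap.mul' ℚ Sym (LinearMap.lTensor Sym V
        ((∏ i : Fin s, hInt (x i - pos (f i))) ⊗ₜ[ℚ]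
          ((∏ i : Fin s, sgn (pos (f i) + (i + 1))) *
            omega (jacobiTrudi s fun i => extendSeq (fun i => pos (f i)) i + 1)))) =
      (-1) ^ r * Λ (fun i => (hInt (x i - pos (f i)) * sgn (pos (f i) + (i + 1))) •
        fun v => eInt (pos (f i) - pos v)) (ribbonRow eInt D) := by
    intro f
    rw [LinearMap.lTensor_tmul, LinearMap.mul'_apply, map_prod_sgn_mul, hV, omega_apply, map_mul,
      omegaHom_ribbonDet, map_pow, map_neg, map_one, MultilinearMap.map_smul_univ,
      smul_apply, hΛ, smul_eq_mul, Finset.prod_mul_distrib]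
    simp only [extendSeq_val]
    change _ * (_ * ((-1) ^ r * _)) = (-1) ^ r * (_ * _ * ribbonDet eInt k D fun i => pos (f i))
    ring
  rw [Finset.sum_congr rfl fun f _ => h1 f, ← Finset.mul_sum, ← sum_apply,
    ← MultilinearMap.map_sum Λ (fun i (y : Fin s ⊕ Fin (k + 1)) =>
      (hInt (x i - pos y) * sgn (pos y + (i + 1))) • fun v => eInt (pos y - pos v)), hΛ]
  -- With `Y = X`, the sum over `y` is an entry of the product of inverse Toeplitz matrices, so only
  -- the column with label `x i` survives.
  have h2 : (fun i : Fin s => ∑ y : Fin s ⊕ Fin (k + 1),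
      (hInt (x i - pos y) * sgn (pos y + (i + 1))) • fun v => eInt (pos y - pos v)) =
      fun (i : Fin s) v => sgn (x i + (i + 1 : ℤ)) *
        if x i = pos (v : Fin s ⊕ Fin (k + 1)) then 1 else 0 := by
    funext i v
    have hv := Finset.mem_Icc.1 (pos_mem v)
    have hxi := Finset.mem_Icc.1 (hx i i.2)
    rw [Finset.sum_apply]
    simp only [Pi.smul_apply, smul_eq_mul]
    rw [sum_pos fun y => hInt (x i - y) * sgn (y + (i + 1)) * eInt (y - pos v)]
    have h3 : ∀ y : ℤ, hInt (x i - y) * sgn (y + (i + 1)) * eInt (y - pos v) =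
        sgn (pos v + (i + 1)) * (hInt (x i - y) * eSigned (y - pos v)) := by
      intro y
      rw [eSigned, sgn_add y, sgn_sub, sgn_add (pos v)]
      linear_combination
        (-hInt (x i - y) * sgn y * sgn (i + 1) * eInt (y - pos v)) * sgn_mul_self (pos v)
    rw [Finset.sum_congr rfl fun y _ => h3 y, ← Finset.mul_sum,
      sum_hInt_mul_eSigned _ _ _ _ hv.1 hxi.2]
    split_ifs with h4
    · rw [h4]
    · rw [mul_zero, mul_zero]
  rw [h2, det_unit_rows hk D (fun i => x i) (fun i => hx i i.2), sgn_natCast, pow_add, pow_add]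
  ring

/-! ### Combinatorics of ribbons -/

theorem mem_rc {μ : YoungDiagram} {c : ℕ × ℕ} : c ∈ rc μ ↔ (c.1 + 1, c.2 + 1) ∈ μ := by
  rw [← YoungDiagram.mem_cells, rc, Finset.mem_filter, YoungDiagram.mem_cells]
  exact ⟨fun hc => hc.2, fun hc =>
    ⟨μ.up_left_mem (Nat.le_succ _) (Nat.le_succ _) hc, hc⟩⟩

theorem colLen_rc (μ : YoungDiagram) (j : ℕ) : (rc μ).colLen j = μ.colLen (j + 1) - 1 := by
  refine eq_of_forall_lt_iff fun i => ?_
  rw [← YoungDiagram.mem_iff_lt_colLen, mem_rc, YoungDiagram.mem_iff_lt_colLen]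
  change i + 1 < μ.colLen (j + 1) ↔ _
  omega

theorem rowLen_rc_le (μ : YoungDiagram) : (rc μ).rowLen 0 ≤ μ.rowLen 0 := by
  by_contra hc
  rw [not_le, ← YoungDiagram.mem_iff_lt_rowLen, mem_rc, YoungDiagram.mem_iff_lt_rowLen] at hc
  change μ.rowLen 0 + 1 < μ.rowLen (0 + 1) at hc
  have := μ.rowLen_anti 0 (0 + 1) (Nat.zero_le _)
  omega

theorem colLen_pos_iff (μ : YoungDiagram) (j : ℕ) : 0 < μ.colLen j ↔ j < μ.rowLen 0 := by
  rw [← YoungDiagram.mem_iff_lt_colLen, YoungDiagram.mem_iff_lt_rowLen]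

namespace Ribbon

variable (R : Ribbon)

theorem zero_mem : (0, 0) ∈ R.outer := by
  have h1 : R.outer.cells.Nonempty := by
    rw [Finset.nonempty_iff_ne_empty]
    intro hc
    exact R.nonempty (YoungDiagram.ext (by rw [hc]; rfl))
  obtain ⟨c, hc⟩ := h1
  exact R.outer.up_left_mem (Nat.zero_le _) (Nat.zero_le _) ((YoungDiagram.mem_cells _).1 hc)

theorem rowLen_pos : 0 < R.outer.rowLen 0 := YoungDiagram.mem_iff_lt_rowLen.1 R.zero_mem

/-- The number of columns, minus one. -/
def width : ℕ := R.outer.rowLen 0 - 1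

theorem rowLen_eq : R.outer.rowLen 0 = R.width + 1 := by
  have := R.rowLen_pos
  rw [width]; omega

theorem colLen_pos {j : ℕ} (hj : j ≤ R.width) : 0 < R.outer.colLen j := by
  rw [colLen_pos_iff, rowLen_eq]; omega

theorem colLen_eq_zero {j : ℕ} (hj : R.width < j) : R.outer.colLen j = 0 := by
  have := colLen_pos_iff R.outer j
  rw [rowLen_eq] at this
  omega

/-- The shifted column lengths. -/
def shiftedLen (i : ℕ) : ℕ := R.outer.colLen i + R.width - i

/-- The shifted lengths of all columns but the first. -/
def code : Finset ℕ := (Finset.range R.width).image fun i => R.shiftedLen (i + 1)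

theorem shiftedLen_lt (i j : ℕ) (hij : i < j) (hj : j ≤ R.width) :
    R.shiftedLen j < R.shiftedLen i := by
  have := R.outer.colLen_anti i j hij.le
  have := R.colLen_pos hj
  simp only [shiftedLen]; omega

theorem shiftedLen_pos (i : ℕ) (hi : i ≤ R.width) : 0 < R.shiftedLen i := by
  have := R.colLen_pos hi
  simp only [shiftedLen]; omega

theorem code_subset : R.code ⊆ Finset.Icc 1 (R.shiftedLen 0 - 1) := by
  intro x hx
  obtain ⟨i, hi, rfl⟩ := Finset.mem_image.1 hx
  have hi' := Finset.mem_range.1 hi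
  have h1 := R.shiftedLen_lt 0 (i + 1) (by omega) (by omega)
  have h2 := R.shiftedLen_pos (i + 1) (by omega)
  rw [Finset.mem_Icc]; omega

theorem mem_cells {x : ℕ × ℕ} :
    x ∈ R.cells ↔ x ∈ R.outer ∧ (x.1 + 1, x.2 + 1) ∉ R.outer := by
  rw [cells, Finset.mem_sdiff, YoungDiagram.mem_cells, YoungDiagram.mem_cells, mem_rc]

/-- The diagonal of a cell, counted from the upper left. -/
def diag (x : ℕ × ℕ) : ℕ := R.outer.colLen 0 + x.2 - x.1

variable {R}

theorem lt_of_mem {x : ℕ × ℕ} (hx : x ∈ R.cells) :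
    x.1 < R.outer.colLen 0 ∧ x.2 ≤ R.width := by
  have h1 := (R.mem_cells.1 hx).1
  have h2 := YoungDiagram.mem_iff_lt_colLen.1 (show (x.1, x.2) ∈ R.outer from h1)
  have h3 := YoungDiagram.mem_iff_lt_rowLen.1 (show (x.1, x.2) ∈ R.outer from h1)
  have h4 := R.outer.colLen_anti 0 x.2 (Nat.zero_le _)
  have h5 := R.outer.rowLen_anti 0 x.1 (Nat.zero_le _)
  rw [rowLen_eq] at h5
  omega

/-- Otherwise the diagonal successor of `y` would lie in the outer diagram, so `y` would have been
removed. Hence a diagonal carries at most one cell. -/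
theorem not_lt_lt {x y : ℕ × ℕ} (hx : x ∈ R.cells) (hy : y ∈ R.cells) :
    ¬ (y.1 < x.1 ∧ y.2 < x.2) := fun hc =>
  (R.mem_cells.1 hy).2 (R.outer.up_left_mem hc.1 hc.2 (R.mem_cells.1 hx).1)

theorem diag_injOn : Set.InjOn R.diag R.cells := by
  intro x hx y hy hxy
  have h1 := not_lt_lt hx hy
  have h2 := not_lt_lt hy hx
  have h3 := lt_of_mem hx
  have h4 := lt_of_mem hy
  simp only [diag] at hxy
  ext <;> omega

theorem exists_diag_eq {c : ℕ} (h1 : 1 ≤ c) (h2 : c ≤ R.shiftedLen 0) :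
    ∃ x ∈ R.cells, R.diag x = c := by
  classical
  set a := R.outer.colLen 0 with ha
  have hmem : (a - c, c - a) ∈ R.outer := by
    rcases le_or_gt c a with h3 | h3
    · have h4 : c - a = 0 := by omega
      rw [h4, YoungDiagram.mem_iff_lt_colLen]
      have := R.colLen_pos (Nat.zero_le _)
      omega
    · have h4 : a - c = 0 := by omega
      rw [h4, YoungDiagram.mem_iff_lt_rowLen, rowLen_eq]
      simp only [shiftedLen] at h2
      omega
  -- Move along the diagonal from its cell in the first row or column; the last cell before leaving
  -- the outer diagram belongs to the ribbon.
  have hex : ∃ t, (a - c + t, c - a + t) ∉ R.outer := by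
    refine ⟨a, fun hc => ?_⟩
    rw [YoungDiagram.mem_iff_lt_colLen] at hc
    have := R.outer.colLen_anti 0 (c - a + a) (Nat.zero_le _)
    omega
  have hspec := Nat.find_spec hex
  have hpos : Nat.find hex ≠ 0 := fun hc => by
    rw [hc] at hspec; exact hspec hmem
  obtain ⟨t, ht⟩ := Nat.exists_eq_succ_of_ne_zero hpos
  have hin := not_not.1 (Nat.find_min hex (show t < Nat.find hex by omega))
  rw [ht] at hspec
  have hcell : (a - c + t, c - a + t) ∈ R.cells := R.mem_cells.2 ⟨hin, hspec⟩
  refine ⟨_, hcell, ?_⟩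
  have := lt_of_mem hcell
  simp only at this
  simp only [diag]
  omega

theorem diag_mem {x : ℕ × ℕ} (hx : x ∈ R.cells) : 1 ≤ R.diag x ∧ R.diag x ≤ R.shiftedLen 0 := by
  have := lt_of_mem hx
  simp only [diag, shiftedLen]; omega

variable (R) in
theorem size_eq : R.size = R.shiftedLen 0 := by
  have h1 : R.cells.card = (Finset.Icc 1 (R.shiftedLen 0)).card :=
    Finset.card_nbij R.diag (fun x hx => Finset.mem_coe.2 (Finset.mem_Icc.2 (diag_mem hx)))
      diag_injOn fun c hc => by
        rw [Finset.coe_Icc, Set.mem_Icc] at hc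
        exact exists_diag_eq hc.1 hc.2
  rw [size, h1, Nat.card_Icc, Nat.add_sub_cancel]

/-- In a ribbon the left-to-right, top-to-bottom order is the order of the diagonals, and each
diagonal `1, …, k` carries exactly one cell. -/
theorem label_eq {x : ℕ × ℕ} (hx : x ∈ R.cells) : R.label x = R.diag x := by
  have h0 : ∀ y ∈ R.cells, (y.2 < x.2 ∨ y.2 = x.2 ∧ x.1 ≤ y.1) ↔ R.diag y ≤ R.diag x := by
    intro y hy
    have h1 := not_lt_lt hx hy
    have h2 := not_lt_lt hy hx
    have h3 := lt_of_mem hx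
    have h4 := lt_of_mem hy
    simp only [diag]
    omega
  rw [label, Finset.filter_congr h0]
  have h1 : (R.cells.filter fun y => R.diag y ≤ R.diag x).card =
      (Finset.Icc 1 (R.diag x)).card := by
    refine Finset.card_nbij R.diag (fun y hy => ?_) (fun y hy y' hy' hyy => ?_) fun c hc => ?_
    · have hy' := Finset.mem_filter.1 hy
      exact Finset.mem_coe.2 (Finset.mem_Icc.2 ⟨(diag_mem hy'.1).1, hy'.2⟩)
    · exact diag_injOn (Finset.mem_filter.1 hy).1 (Finset.mem_filter.1 hy').1 hyy
    · rw [Finset.coe_Icc, Set.mem_Icc] at hc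
      obtain ⟨y, hy, hyc⟩ := exists_diag_eq hc.1 (hc.2.trans (diag_mem hx).2)
      exact ⟨y, Finset.mem_coe.2 (Finset.mem_filter.2 ⟨hy, hyc ▸ hc.2⟩), hyc⟩
  rw [h1, Nat.card_Icc, Nat.add_sub_cancel]

variable (R) in
-- Consecutive cells are joined by a step down or a step right. A step right enters a column `J + 1`
-- at its top cell, whose diagonal is `k - d_{J+1} + 1`; this is the step from label `i` to `i + 1`
-- exactly when `d_{J+1} = k - i`.
theorem mem_descentSet_iff (i : ℕ) (hi : i ∈ Finset.Icc 1 (R.size - 1)) :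
    i ∈ R.descentSet ↔ R.size - i ∉ R.code := by
  have hi' := Finset.mem_Icc.1 hi
  have hk := R.size_eq
  rw [descentSet, Finset.mem_filter]
  constructor
  · rintro ⟨-, x, hx, y, hy, hxi, hyi, hlt⟩ hcode
    rw [label_eq hx] at hxi
    rw [label_eq hy] at hyi
    obtain ⟨J, hJ, hJi⟩ := Finset.mem_image.1 hcode
    have hJ' := Finset.mem_range.1 hJ
    have hpos := R.colLen_pos (j := J + 1) (by omega)
    have hanti := R.outer.colLen_anti 0 (J + 1) (Nat.zero_le _)
    set b := R.outer.colLen (J + 1) with hb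
    have hv0 : (b - 1, J + 1) ∈ R.outer := YoungDiagram.mem_iff_lt_colLen.2 (by omega)
    have hu : (b - 1, J) ∈ R.cells := by
      refine R.mem_cells.2 ⟨R.outer.up_left_mem le_rfl (Nat.le_succ _) hv0, ?_⟩
      rw [YoungDiagram.mem_iff_lt_colLen]
      simp only; omega
    have hv : (b - 1, J + 1) ∈ R.cells := by
      refine R.mem_cells.2 ⟨hv0, ?_⟩
      rw [YoungDiagram.mem_iff_lt_colLen]
      have := R.outer.colLen_anti (J + 1) (J + 1 + 1) (Nat.le_succ _)
      simp only; omega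
    simp only [shiftedLen] at hJi hk
    have hxu : x = (b - 1, J) := diag_injOn hx hu (by
      rw [hxi]; simp only [diag]; omega)
    have hyv : y = (b - 1, J + 1) := diag_injOn hy hv (by
      rw [hyi]; simp only [diag]; omega)
    rw [hxu, hyv] at hlt
    exact lt_irrefl _ hlt
  · intro hcode
    obtain ⟨x, hx, hxi⟩ := exists_diag_eq (R := R) hi'.1 (by omega)
    obtain ⟨y, hy, hyi⟩ := exists_diag_eq (R := R) (c := i + 1) (by omega) (by omega)
    refine ⟨hi, x, hx, y, hy, by rw [label_eq hx, hxi], by rw [label_eq hy, hyi], ?_⟩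
    by_contra hlt
    have h1 := not_lt_lt hx hy
    have h2 := not_lt_lt hy hx
    have h3 := lt_of_mem hx
    have h4 := lt_of_mem hy
    simp only [diag] at hxi hyi
    have h5 : y.1 = x.1 := by omega
    have h6 : y.2 = x.2 + 1 := by omega
    have h7 := YoungDiagram.mem_iff_lt_colLen.1
      (show (y.1, y.2) ∈ R.outer from (R.mem_cells.1 hy).1)
    have h8 := (R.mem_cells.1 hx).2
    rw [YoungDiagram.mem_iff_lt_colLen] at h8
    rw [h6] at h7
    refine hcode (Finset.mem_image.2 ⟨x.2, Finset.mem_range.2 (by omega), ?_⟩)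
    simp only [shiftedLen] at hk ⊢
    omega

/-- A code is the complement of the descent set reversed by `i ↦ k - i`, and this reversal is an
involution of `[1, k - 1]` commuting with complements. -/
theorem isComplement_iff {R' : Ribbon} : R.IsComplement R' ↔
    R'.size = R.size ∧ R'.code = Finset.Icc 1 (R.size - 1) \ R.code := by
  have hsub : ∀ Q : Ribbon, Q.code ⊆ Finset.Icc 1 (Q.size - 1) := fun Q => by
    rw [size_eq]; exact Q.code_subset
  have hdes : ∀ Q : Ribbon, Q.descentSet ⊆ Finset.Icc 1 (Q.size - 1) := fun Q =>
    Finset.filter_subset _ _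
  rw [IsComplement]
  refine and_congr_right fun hs => ?_
  have hrev : ∀ i ∈ Finset.Icc 1 (R.size - 1), R.size - i ∈ Finset.Icc 1 (R.size - 1) ∧
      R.size - (R.size - i) = i := by
    intro i hi
    rw [Finset.mem_Icc] at hi ⊢
    omega
  constructor
  · intro hd
    ext i
    rw [Finset.mem_sdiff]
    by_cases hi : i ∈ Finset.Icc 1 (R.size - 1)
    · obtain ⟨hi1, hi2⟩ := hrev i hi
      have h1 := R.mem_descentSet_iff _ hi1
      have h2 := R'.mem_descentSet_iff (R.size - i) (by rw [hs]; exact hi1)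
      rw [hd, Finset.mem_sdiff, h1, hs, hi2] at h2
      tauto
    · have := hsub R'
      rw [hs] at this
      exact ⟨fun hc => absurd (this hc) hi, fun hc => absurd hc.1 hi⟩
  · intro hd
    ext i
    rw [Finset.mem_sdiff]
    by_cases hi : i ∈ Finset.Icc 1 (R.size - 1)
    · have h1 := R.mem_descentSet_iff _ hi
      have h2 := R'.mem_descentSet_iff i (by rw [hs]; exact hi)
      have h3 := (hrev i hi).1
      rw [hs, hd, Finset.mem_sdiff] at h2
      tauto
    · have := hdes R'
      rw [hs] at this
      exact ⟨fun hc => absurd (this hc) hi, fun hc => absurd hc.1 hi⟩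

variable (R) in
theorem card_code : R.code.card = R.width := by
  rw [code, Finset.card_image_of_injOn, Finset.card_range]
  intro i hi j hj hij
  have hi' := Finset.mem_range.1 (Finset.mem_coe.1 hi)
  have hj' := Finset.mem_range.1 (Finset.mem_coe.1 hj)
  by_contra hne
  rcases lt_or_gt_of_ne hne with h1 | h1
  · exact (R.shiftedLen_lt (i + 1) (j + 1) (by omega) (by omega)).ne' hij
  · exact (R.shiftedLen_lt (j + 1) (i + 1) (by omega) (by omega)).ne hij

variable (R) in
theorem shiftedLen_eq_orderEmbOfFin {n : ℕ} (hn : R.code.card = n) (i : Fin n) :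
    R.shiftedLen (n - i) = R.code.orderEmbOfFin hn i := by
  have hw : R.width = n := by rw [← hn, card_code]
  have := Finset.orderEmbOfFin_unique hn (f := fun i : Fin n => R.shiftedLen (n - i))
    (fun i => Finset.mem_image.2 ⟨n - 1 - i, Finset.mem_range.2 (by omega), by
      congr 1; omega⟩)
    (fun i j hij => by
      have : (i : ℕ) < j := hij
      exact R.shiftedLen_lt _ _ (by omega) (by omega))
  exact congrFun this i

/-- A ribbon is determined by its size and its code. -/
theorem eq_of_code_eq {R' : Ribbon} (hs : R.size = R'.size) (hc : R.code = R'.code) :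
    R = R' := by
  have hw : R.width = R'.width := by rw [← card_code, ← card_code, hc]
  have hlen : ∀ i ≤ R.width, R.shiftedLen i = R'.shiftedLen i := by
    intro i hi
    rcases Nat.eq_zero_or_pos i with rfl | h0
    · rw [← size_eq, ← size_eq, hs]
    · have h1 := R.shiftedLen_eq_orderEmbOfFin R.card_code ⟨R.width - i, by omega⟩
      have h2 := R'.shiftedLen_eq_orderEmbOfFin (n := R.width) (by rw [card_code, hw])
        ⟨R.width - i, by omega⟩
      simp only [hc] at h1
      have h3 : R.width - (R.width - i) = i := by omega
      simp only [h3] at h1 h2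
      rw [h1, h2]
  have hcol : ∀ j, R.outer.colLen j = R'.outer.colLen j := by
    intro j
    rcases le_or_gt j R.width with hj | hj
    · have := hlen j hj
      simp only [shiftedLen] at this
      omega
    · rw [R.colLen_eq_zero hj, R'.colLen_eq_zero (by omega)]
  refine Ribbon.ext (YoungDiagram.ext ?_)
  ext ⟨i, j⟩
  rw [YoungDiagram.mem_cells, YoungDiagram.mem_cells, YoungDiagram.mem_iff_lt_colLen,
    YoungDiagram.mem_iff_lt_colLen, hcol]

/-- The Young diagram with given column lengths. -/
def ofColLens (n : ℕ) (a : ℕ → ℕ) (ha : ∀ i j, i ≤ j → j < n → a j ≤ a i) : YoungDiagram where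
  cells := ((Finset.range (a 0)) ×ˢ (Finset.range n)).filter fun c => c.1 < a c.2
  isLowerSet := by
    intro c d hdc hc
    have h1 : d.1 ≤ c.1 := hdc.1
    have h2 : d.2 ≤ c.2 := hdc.2
    rw [Finset.mem_coe, Finset.mem_filter, Finset.mem_product, Finset.mem_range,
      Finset.mem_range] at hc ⊢
    have h3 := ha d.2 c.2 h2 hc.1.2
    omega

theorem mem_ofColLens {n : ℕ} {a : ℕ → ℕ} {ha : ∀ i j, i ≤ j → j < n → a j ≤ a i} {i j : ℕ} :
    (i, j) ∈ ofColLens n a ha ↔ j < n ∧ i < a j := by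
  rw [← YoungDiagram.mem_cells, ofColLens, Finset.mem_filter, Finset.mem_product,
    Finset.mem_range, Finset.mem_range]
  constructor
  · intro hc; exact ⟨hc.1.2, hc.2⟩
  · intro hc
    have := ha 0 j (Nat.zero_le _) hc.1
    simp only
    omega

/-- Every set of codes occurs. -/
theorem exists_of_code (k : ℕ) (hk : 1 ≤ k) (D : Finset ℕ) (hD : D ⊆ Finset.Icc 1 (k - 1)) :
    ∃ Q : Ribbon, Q.size = k ∧ Q.code = D := by
  obtain ⟨n, hn⟩ : ∃ n, D.card = n := ⟨_, rfl⟩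
  -- The intended shifted column lengths: `k`, followed by the elements of `D` in decreasing order.
  let d : ℕ → ℕ := fun i =>
    if hi : 1 ≤ i ∧ i ≤ n then D.orderEmbOfFin hn ⟨n - i, by omega⟩ else k
  have hdD : ∀ i, 1 ≤ i → i ≤ n → d i ∈ D := by
    intro i h1 h2
    simp only [d, dif_pos (And.intro h1 h2)]
    exact Finset.orderEmbOfFin_mem _ _ _
  have hd0 : d 0 = k := by simp [d]
  have hdstep : ∀ i, i < n → d (i + 1) < d i := by
    intro i hi
    have h1 := Finset.mem_Icc.1 (hD (hdD (i + 1) (by omega) (by omega)))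
    rcases Nat.eq_zero_or_pos i with rfl | h0
    · rw [hd0]; omega
    · simp only [d]
      rw [dif_pos (by omega), dif_pos (by omega), (D.orderEmbOfFin hn).lt_iff_lt, Fin.lt_def]
      simp only; omega
  have hdlt : ∀ i m, i + m ≤ n → d (i + m) + m ≤ d i := by
    intro i m
    induction m with
    | zero => intro _; simp
    | succ m ih =>
      intro hm
      have h1 := ih (by omega)
      have h2 := hdstep (i + m) (by omega)
      have h3 : i + (m + 1) = i + m + 1 := rfl
      rw [h3]; omega
  have hdpos : ∀ i, i ≤ n → n - i < d i := by
    intro i hi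
    have h1 := hdlt i (n - i) (by omega)
    have h2 : i + (n - i) = n := by omega
    rw [h2] at h1
    have h3 : 0 < d n := by
      rcases Nat.eq_zero_or_pos n with h0 | h0
      · rw [h0, hd0]; omega
      · exact (Finset.mem_Icc.1 (hD (hdD n h0 le_rfl))).1
    omega
  -- Undoing the staircase shift gives the column lengths; for `i ≤ n` the bound `n - i < d i` makes
  -- the subtraction exact and the columns nonempty.
  let a : ℕ → ℕ := fun i => d i + i - n
  have ha : ∀ i j, i ≤ j → j < n + 1 → a j ≤ a i := by
    intro i j hij hj
    obtain ⟨m, rfl⟩ := Nat.exists_eq_add_of_le hij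
    have := hdlt i m (by omega)
    simp only [a]; omega
  have hapos : ∀ j, j < n + 1 → 0 < a j := by
    intro j hj
    have := hdpos j (by omega)
    simp only [a]; omega
  have h00 : (0, 0) ∈ ofColLens (n + 1) a ha :=
    mem_ofColLens.2 ⟨Nat.succ_pos n, hapos 0 (Nat.succ_pos n)⟩
  let Q : Ribbon := ⟨ofColLens (n + 1) a ha, fun hc => by
    rw [hc] at h00; exact YoungDiagram.notMem_bot _ h00⟩
  have hcol : ∀ j, j < n + 1 → Q.outer.colLen j = a j := by
    intro j hj
    refine eq_of_forall_lt_iff fun i => ?_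
    rw [← YoungDiagram.mem_iff_lt_colLen, mem_ofColLens]
    tauto
  have hrow : Q.outer.rowLen 0 = n + 1 := by
    refine eq_of_forall_lt_iff fun j => ?_
    rw [← YoungDiagram.mem_iff_lt_rowLen, mem_ofColLens]
    exact ⟨fun hj => hj.1, fun hj => ⟨hj, hapos j hj⟩⟩
  have hw : Q.width = n := by rw [width, hrow]; rfl
  have hlen : ∀ i, i ≤ n → Q.shiftedLen i = d i := by
    intro i hi
    have := hdpos i hi
    simp only [shiftedLen, hcol i (by omega), hw, a]
    omega
  refine ⟨Q, by rw [size_eq, hlen 0 (Nat.zero_le _), hd0], ?_⟩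
  refine Finset.eq_of_subset_of_card_le ?_ (by rw [card_code, hw, hn])
  intro x hx
  obtain ⟨i, hi, rfl⟩ := Finset.mem_image.1 hx
  rw [hw, Finset.mem_range] at hi
  rw [hlen (i + 1) (by omega)]
  exact hdD (i + 1) (by omega) (by omega)

variable (R) in
theorem existsUnique_isComplement : ∃! R' : Ribbon, R.IsComplement R' := by
  have hk : 1 ≤ R.size := by
    rw [size_eq]; exact R.shiftedLen_pos 0 (Nat.zero_le _)
  obtain ⟨Q, hQ, hQc⟩ := exists_of_code R.size hk (Finset.Icc 1 (R.size - 1) \ R.code)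
    Finset.sdiff_subset
  refine ⟨Q, isComplement_iff.2 ⟨hQ, hQc⟩, fun Q' hQ' => ?_⟩
  obtain ⟨h1, h2⟩ := isComplement_iff.1 hQ'
  exact eq_of_code_eq (h1.trans hQ.symm) (h2.trans hQc.symm)

/-! ### The action of ribbon operators -/

variable (R) in
/-- A ribbon operator acts by `ribbonDet`. -/
theorem operator_omega_jacobiTrudi (s : ℕ) (f : ℕ → ℤ) :
    R.operator (omega (jacobiTrudi s fun i => f i + 1)) =
      omega ((-1) ^ R.width * ribbonDet (s := s) hInt R.size R.code fun i => f i) := by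
  have hprod := prod_STilde_jacobiTrudi (R.width + 1) (fun j => (R.outer.colLen j : ℤ)) s
    (fun i => f i + 1)
  rw [← rowLen_eq] at hprod
  rw [operator, LinearMap.comp_apply, hprod, schur_eq_omega_jacobiTrudi
    (s := s + R.outer.rowLen 0) ((rowLen_rc_le R.outer).trans (Nat.le_add_left _ _)),
    skew_omega, skew_jacobiTrudi _ _ _ (fun l hl => by omega), rowLen_eq]
  have h1 := det_eq_ribbonDet (s := s) (k := R.size) R.width R.shiftedLen R.size_eq.symm
    R.shiftedLen_lt R.shiftedLen_pos f
  rw [code, ← h1]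
  congr 2
  ext1 i l
  simp only [Matrix.of_apply, colLen_rc]
  congr 1
  -- Adding the width to row and column labels alike turns them into shifted lengths. Beyond the
  -- last column the truncated `0 - 1 = 0` yields the labels `0, -1, …`.
  have hl : ((R.outer.colLen ((l : ℕ) + 1) - 1 : ℕ) : ℤ) - (l : ℕ) + R.width =
      if (l : ℕ) < R.width then (R.shiftedLen (l + 1) : ℤ) else -((l : ℤ) - R.width) := by
    split_ifs with h2
    · have := R.colLen_pos (j := l + 1) (by omega)
      simp only [shiftedLen]
      omega
    · rw [R.colLen_eq_zero (by omega)]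
      push_cast; ring
  rw [← hl]
  split_ifs with h2
  · simp only [shiftedLen]
    omega
  · push_cast; ring

/-- The two codes partition `[1, k - 1]`, and each has as many elements as the width of its ribbon.
-/
theorem width_add_width {R' : Ribbon} (h : R.IsComplement R') :
    R.width + R'.width + 1 = R.size := by
  obtain ⟨-, h2⟩ := isComplement_iff.1 h
  have hsub : R.code ⊆ Finset.Icc 1 (R.size - 1) := by
    rw [size_eq]; exact R.code_subset
  have h3 := Finset.card_sdiff_add_card_eq_card hsub
  have hk := R.shiftedLen_pos 0 (Nat.zero_le _)
  rw [← size_eq] at hk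
  rw [← h2, card_code, card_code, Nat.card_Icc] at h3
  omega

theorem kLevelEq {R' : Ribbon} (h : R.IsComplement R') :
    KLevelEq R.size (omega ∘ₗ hat R.operator ∘ₗ omega) R'.operator := by
  intro ν hν
  have hk : 1 ≤ R.size := by
    rw [size_eq]; exact R.shiftedLen_pos 0 (Nat.zero_le _)
  obtain ⟨hs, hc⟩ := isComplement_iff.1 h
  let x : ℕ → ℤ := fun i => (ν.colLen i : ℤ) - i - 1
  -- The bound on `ℓ(ν)` enters only here: it bounds the column lengths, and so keeps the labels
  -- inside the window.
  have hx : ∀ i < ν.rowLen 0, x i ∈ Finset.Icc (-(ν.rowLen 0 : ℤ)) R.size := by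
    intro i hi
    have := ν.colLen_anti 0 i (Nat.zero_le _)
    rw [Finset.mem_Icc]
    simp only [x]; omega
  have hschur : schur ν = omega (jacobiTrudi (ν.rowLen 0) fun i => x i + 1) := by
    rw [schur_eq_omega_jacobiTrudi le_rfl]
    congr 1
    exact jacobiTrudi_congr _ _ _ fun i _ => by simp only [x]; ring
  rw [hschur, operator_omega_jacobiTrudi, LinearMap.comp_apply, LinearMap.comp_apply, omega_omega,
    hat_jacobiTrudi hk R.code R.operator (R.operator_omega_jacobiTrudi _) x hx, hc, hs]
  have hw := width_add_width h
  have hpow : ((-1) ^ (R.width + R.size + 1) : Sym) = (-1) ^ R'.width := by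
    have : R.width + R.size + 1 = 2 * (R.width + 1) + R'.width := by omega
    rw [this, pow_add, pow_mul]; simp
  rw [hpow]

end Ribbon

end RibbonOps

theorem theorem7 (R : RibbonOps.Ribbon) :
    (∃! Rbar : RibbonOps.Ribbon, R.IsComplement Rbar) ∧
    ∀ Rbar : RibbonOps.Ribbon, R.IsComplement Rbar →
      RibbonOps.KLevelEq R.size
        (RibbonOps.omega ∘ₗ RibbonOps.hat R.operator ∘ₗ RibbonOps.omega)
        Rbar.operator :=
  ⟨R.existsUnique_isComplement, fun _ h => RibbonOps.Ribbon.kLevelEq h⟩
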